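/- **Setting.** Let $n\ge 1$, let $M\in\mathbb R^{n\times n}$ be positive semidefinite (i.e. $u^TMu\ge 0$ for all $u$; $M$ need not be symmetric) and $q\in\mathbb R^n$. Operations on vectors in $\mathbb R^n$ are componentwise, $e$ is the all-ones vector. Put $\mathcal F=\{(x,s): -Mx+s=q,\ x,s\ge 0\}$ and $\mathcal F^+=\{(x,s): -Mx+s=q,\ x,s>0\}$, and assume $\mathcal F^+\ne\emptyset$. For $z=(x,s,w)$ with $w=(v_0,v)\in\mathbb R^{1+n}$ let $r_0(z)=v_0-x^Ts$, $r_i(z)=x_is_i-v_i^2$ $(1\le i\le n)$, $\rho(w)=\frac{v_0-\|v\|^2}{n+1}$, and $$\mathcal F_z^+=\{z:(x,s)\in\mathcal F^+,\ r_i(z)>0,\ 0\le i\le n\},\qquad F(z)=-\sum_{i=0}^n\ln r_i(z)\quad(z\in\mathcal F_z^+),$$ with $F=+\infty$ outside $\mathcal F_z^+$. Let $\phi(w)=\min_{(x,s)}F(x,s,w)$ and $\Psi(z)=F(z)-\phi(w)$. With $\hat r_i(z)=\sqrt{r_i(z)/\rho(w)}$, $0\le i\le n$, let $$\delta(z)=\frac{\sum_{i=0}^n(\hat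 r_i-1/\hat r_i)^2}{\bigl(\sum_{i=0}^n(1/\hat r_i^2-1)^2\bigr)^{1/2}}\qquad(\delta(z)=0\text{ if the denominator vanishes}).$$ Let $\mathcal N_\Psi(\tau)=\{z\in\mathcal F_z^+:\Psi(z)\le\tau\}$ and $\mathcal N_\delta(\beta)=\{z\in\mathcal F_z^+:\delta(z)\le\beta\}$. Let $\omega(t)=t-\ln(1+t)$ and $\omega_*(t)=-t-\ln(1-t)$. For $a\in\mathbb R^n$ the direction $(\Delta x,\Delta s)$ solves $-M\Delta x+\Delta s=0$, $s\,\Delta x+x\,\Delta s=a$. The corrector direction uses $a_c(z)=\rho(w)e-xs+v^2$, the universal-tangent direction uses $a_{ut}(z)=\bigl(\frac{\|v\|^2}{n+1}-\rho(w)\bigr)e-2v^2$, and the auto-corrector direction uses $a_{ac}(z)=a_{ut}(z)+a_c(z)$. **Algorithm** (parabolic target-space IPA). Input: $\varepsilon>0$, $\beta$, $\tau$, a choice of $a_p\in\{a_{ut},a_{ac}\}$, and a starting point $z^{(0)}=(x^{(0)},s^{(0)},w^{(0)})\in\mathcal N_\delta(\beta)$. While $v_0>\varepsilon$, perform an outer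 iteration: * Predictor step: compute the direction for $a_p(z)$, let $\alpha_p=\sup\{\alpha\in[0,1]:(x+\alpha\Delta x,\,s+\alpha\Delta s,\,(1-\alpha)w)\in\mathcal N_\Psi(\tau)\}$, and replace $z$ by $(x+\alpha_p\Delta x,\,s+\alpha_p\Delta s,\,(1-\alpha_p)w)$. * Corrector steps: while $z\notin\mathcal N_\delta(\beta)$ and $v_0\neq 0$, compute the direction for $a_c(z)$, let $\alpha_c$ minimize $F(x+\alpha\Delta x,\,s+\alpha\Delta s,\,w)$ over $\alpha\in[0,1]$, and replace $(x,s)$ by $(x+\alpha_c\Delta x,\,s+\alpha_c\Delta s)$. **Theorem.** Let $\beta=\frac14$ and $\tau=\omega_*\bigl(\frac{2\beta}{1-\beta}\bigr)$. For either choice of $a_p$ and every $z^{(0)}\in\mathcal N_\delta(\beta)$, every step of the algorithm is well defined, and the algorithm terminates with a feasible pair $(x,s)\in\mathcal F$ satisfying $x^Ts\le\varepsilon$. It performs at most $$\max\Bigl\{0,\Bigl\lceil 4\sqrt n\,\ln\frac{\mu^*(w^{(0)})}{\varepsilon}\Bigr\rceil\Bigr\},\qquad \mu^*(w)=\frac{v_0^2}{v_0-\|v\|^2},$$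 outer iterations, each of which contains at most $\Bigl\lfloor\tau\big/\omega\bigl(\tfrac{\beta}{\sqrt{1+2\beta}}\bigr)\Bigr\rfloor+1$ corrector steps. -/

import Mathlib

open Matrix

noncomputable section

namespace PTS

/-- The function `ω(t) = t - ln (1 + t)`, used for `t ≥ 0`. -/
def omega (t : ℝ) : ℝ := t - Real.log (1 + t)

/-- The function `ω_*(t) = -t - ln (1 - t)`, used for `0 ≤ t < 1`. -/
def omegaStar (t : ℝ) : ℝ := -t - Real.log (1 - t)

/-- The Euclidean norm `‖u‖ = √(uᵀu)`. -/
def euclNorm {m : ℕ} (u : Fin m → ℝ) : ℝ := Real.sqrt (u ⬝ᵥ u)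

/-- A vector `w = (v₀, v) ∈ ℝ^{1+n}`. -/
@[ext]
structure Target (n : ℕ) where
  v0 : ℝ
  v : Fin n → ℝ

/-- A triple `z = (x, s, w)`. -/
@[ext]
structure Point (n : ℕ) where
  x : Fin n → ℝ
  s : Fin n → ℝ
  w : Target n

variable {n : ℕ}

/-- Positive semidefiniteness `uᵀ M u ≥ 0` of a real square matrix that need not be symmetric
(Mathlib's `Matrix.PosSemidef` would impose symmetry, which is not assumed for monotone
linear complementarity problems). -/
def IsMonotoneMatrix (M : Matrix (Fin n) (Fin n) ℝ) : Prop :=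
  ∀ u : Fin n → ℝ, 0 ≤ u ⬝ᵥ (M *ᵥ u)

/-- The set `𝓕` of feasible pairs `(x, s)`: `-M x + s = q`, `x ≥ 0`, `s ≥ 0`. -/
def feasible (M : Matrix (Fin n) (Fin n) ℝ) (q : Fin n → ℝ) :
    Set ((Fin n → ℝ) × (Fin n → ℝ)) :=
  {p | -(M *ᵥ p.1) + p.2 = q ∧ (∀ i, 0 ≤ p.1 i) ∧ (∀ i, 0 ≤ p.2 i)}

/-- The set `𝓕⁺` of strictly feasible pairs `(x, s)`: `-M x + s = q`, `x > 0`, `s > 0`. -/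
def strictlyFeasible (M : Matrix (Fin n) (Fin n) ℝ) (q : Fin n → ℝ) :
    Set ((Fin n → ℝ) × (Fin n → ℝ)) :=
  {p | -(M *ᵥ p.1) + p.2 = q ∧ (∀ i, 0 < p.1 i) ∧ (∀ i, 0 < p.2 i)}

/-- The residuals `r₀(z) = v₀ - xᵀs` and `rᵢ(z) = xᵢ sᵢ - vᵢ²`, `i = 1, …, n`. -/
def residual (z : Point n) : Fin (n + 1) → ℝ :=
  Fin.cons (z.w.v0 - z.x ⬝ᵥ z.s) (fun i => z.x i * z.s i - z.w.v i ^ 2)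

/-- The set `𝓕_z⁺`: the strictly feasible pairs `(x, s)`, together with a target `w`, at which all
residuals are positive. It is the domain of the barrier `F`, and it is the relative interior of
`𝓕_z = {(x, s, w) : (x, s) ∈ 𝓕, v₀ ≥ ‖v‖², x s ≥ v², xᵀs ≤ v₀}` when `𝓕⁺` is nonempty
(the inequality `v₀ > ‖v‖²` is implied). -/
def strictSet (M : Matrix (Fin n) (Fin n) ℝ) (q : Fin n → ℝ) : Set (Point n) :=
  {z | (z.x, z.s) ∈ strictlyFeasible M q ∧ ∀ i, 0 < residual z i}

/-- `ρ(w) = (v₀ - ‖v‖²) / (n + 1)`. -/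
def rho (w : Target n) : ℝ := (w.v0 - w.v ⬝ᵥ w.v) / ((n : ℝ) + 1)

/-- The barrier `F(z) = -∑_{i=0}^n ln rᵢ(z)`, used on `𝓕_z⁺`. -/
def barrier (z : Point n) : ℝ := -∑ i, Real.log (residual z i)

/-- The control barrier `φ(w)`: the minimum of `F(x, s, w)` over all `(x, s)` with
`(x, s, w) ∈ 𝓕_z`. Since `F` is `+∞` on the rest of `𝓕_z`, only `𝓕_z⁺` matters. -/
def controlBarrier (M : Matrix (Fin n) (Fin n) ℝ) (q : Fin n → ℝ) (w : Target n) : ℝ :=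
  sInf {t | ∃ x s : Fin n → ℝ, (⟨x, s, w⟩ : Point n) ∈ strictSet M q ∧ t = barrier ⟨x, s, w⟩}

/-- The functional proximity measure `Ψ(z) = F(z) - φ(w)`. -/
def Psi (M : Matrix (Fin n) (Fin n) ℝ) (q : Fin n → ℝ) (z : Point n) : ℝ :=
  barrier z - controlBarrier M q z.w

/-- The neighbourhood `𝓝_Ψ(τ) = {z ∈ 𝓕_z⁺ : Ψ(z) ≤ τ}`. -/
def nbhdPsi (M : Matrix (Fin n) (Fin n) ℝ) (q : Fin n → ℝ) (τ : ℝ) : Set (Point n) :=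
  {z | z ∈ strictSet M q ∧ Psi M q z ≤ τ}

/-- The scaled residuals `r̂(z) = √(r(z) / ρ(w))`. -/
def rhat (z : Point n) (i : Fin (n + 1)) : ℝ := Real.sqrt (residual z i / rho z.w)

/-- `ζ₀(z) = ‖r̂(z) - 1 / r̂(z)‖`. -/
def zeta0 (z : Point n) : ℝ := euclNorm (fun i => rhat z i - 1 / rhat z i)

/-- `ζ₁(z) = ‖1 / r̂²(z) - ē‖`. -/
def zeta1 (z : Point n) : ℝ := euclNorm (fun i => 1 / rhat z i ^ 2 - 1)

open Classical in
/-- `δ(z) = ζ₀²(z) / ζ₁(z)`, and `δ(z) = 0` if `ζ₁(z) = 0`. -/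
def delta (z : Point n) : ℝ := if zeta1 z = 0 then 0 else zeta0 z ^ 2 / zeta1 z

/-- The neighbourhood `𝓝_δ(β) = {z ∈ 𝓕_z⁺ : δ(z) ≤ β}`. -/
def nbhdDelta (M : Matrix (Fin n) (Fin n) ℝ) (q : Fin n → ℝ) (β : ℝ) : Set (Point n) :=
  {z | z ∈ strictSet M q ∧ delta z ≤ β}

/-- The merit function `μ*(w) = v₀² / (v₀ - ‖v‖²)`. -/
def meritStar (w : Target n) : ℝ := w.v0 ^ 2 / (w.v0 - w.v ⬝ᵥ w.v)

/-- `(Δx, Δs)` solves `-M Δx + Δs = 0`, `S Δx + X Δs = a`, with `X = diag(x)`, `S = diag(s)`. -/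
def IsDirection (M : Matrix (Fin n) (Fin n) ℝ) (z : Point n) (a dx ds : Fin n → ℝ) : Prop :=
  -(M *ᵥ dx) + ds = 0 ∧ ∀ i, z.s i * dx i + z.x i * ds i = a i

/-- Right-hand side of the corrector direction, `a_c(z) = ρ(w) e - x s + v²`. -/
def rhsCorrector (z : Point n) (i : Fin n) : ℝ :=
  rho z.w - z.x i * z.s i + z.w.v i ^ 2

/-- Right-hand side of the universal tangent direction,
`a_ut(z) = (‖v‖² / (n + 1) - ρ(w)) e - 2 v²`. -/
def rhsUniversalTangent (z : Point n) (i : Fin n) : ℝ :=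
  ((z.w.v ⬝ᵥ z.w.v) / ((n : ℝ) + 1) - rho z.w) - 2 * z.w.v i ^ 2

/-- Right-hand side of the auto-corrector direction, `a_ac(z) = a_ut(z) + a_c(z)`. -/
def rhsAutoCorrector (z : Point n) (i : Fin n) : ℝ :=
  rhsUniversalTangent z i + rhsCorrector z i

/-- The two predictor strategies. -/
inductive Predictor
  | universalTangent
  | autoCorrector

/-- The right-hand side `a_p(z)` of the chosen predictor strategy. -/
def rhsPredictor : Predictor → Point n → Fin n → ℝ
  | .universalTangent => rhsUniversalTangent
  | .autoCorrector => rhsAutoCorrector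

/-- `(x + α Δx, s + α Δs, (1 - α) w)`. -/
def predictorPoint (z : Point n) (dx ds : Fin n → ℝ) (α : ℝ) : Point n :=
  ⟨z.x + α • dx, z.s + α • ds, ⟨(1 - α) * z.w.v0, (1 - α) • z.w.v⟩⟩

/-- `(x + α Δx, s + α Δs, w)`. -/
def correctorPoint (z : Point n) (dx ds : Fin n → ℝ) (α : ℝ) : Point n :=
  ⟨z.x + α • dx, z.s + α • ds, z.w⟩

/-- `z'` is the result of a predictor step at `z`: a move along the predictor direction with the
largest step length `α ∈ [0,1]` for which the point stays in `𝓝_Ψ(τ)`. The step length is taken as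
a least upper bound, because the maximum is not attained in the case where all `α < 1` are
admissible; then `α = 1`, and the target becomes `w = 0`. -/
def PredictorStep (M : Matrix (Fin n) (Fin n) ℝ) (q : Fin n → ℝ) (p : Predictor) (τ : ℝ)
    (z z' : Point n) : Prop :=
  ∃ (dx ds : Fin n → ℝ) (α : ℝ), IsDirection M z (rhsPredictor p z) dx ds ∧
    IsLUB {t : ℝ | t ∈ Set.Icc (0 : ℝ) 1 ∧ predictorPoint z dx ds t ∈ nbhdPsi M q τ} α ∧
    z' = predictorPoint z dx ds α

/-- `z'` is the result of a corrector step at `z`: a move along the corrector direction with a step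
length that minimizes the barrier `F` over `α ∈ [0,1]` (`F` is `+∞` outside `𝓕_z⁺`). -/
def CorrectorStep (M : Matrix (Fin n) (Fin n) ℝ) (q : Fin n → ℝ) (z z' : Point n) : Prop :=
  ∃ (dx ds : Fin n → ℝ) (α : ℝ), IsDirection M z (rhsCorrector z) dx ds ∧
    (α ∈ Set.Icc (0 : ℝ) 1 ∧ correctorPoint z dx ds α ∈ strictSet M q) ∧
    (∀ t ∈ Set.Icc (0 : ℝ) 1, correctorPoint z dx ds t ∈ strictSet M q →
      barrier (correctorPoint z dx ds α) ≤ barrier (correctorPoint z dx ds t)) ∧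
    z' = correctorPoint z dx ds α

/-- The control state of the algorithm: about to test the condition of the outer loop, about to
test the condition of the inner loop, or halted. -/
inductive Phase
  | outer
  | inner
  | halted

/-- A configuration of the algorithm: the control state, the current point, the number of outer
iterations (predictor steps) started so far, and the number of corrector steps made so far in the
current outer iteration. -/
structure Config (n : ℕ) where
  phase : Phase
  z : Point n
  iters : ℕ
  correctors : ℕ

/-- The initial configuration. -/
def initial (z : Point n) : Config n := ⟨.outer, z, 0, 0⟩

/-- One step of the parabolic target-space interior-point algorithm. The outer loop runs while
`v₀ > ε`; its body is a predictor step followed by the inner loop, which makes corrector steps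
until the point is in `𝓝_δ(β)`. The inner loop is also left if the predictor step has reached the
target `w = 0`, that is, `v₀ = 0`. -/
inductive Step (M : Matrix (Fin n) (Fin n) ℝ) (q : Fin n → ℝ) (p : Predictor) (β τ ε : ℝ) :
    Config n → Config n → Prop
  | finish {z : Point n} {k c : ℕ} (h : z.w.v0 ≤ ε) :
      Step M q p β τ ε ⟨.outer, z, k, c⟩ ⟨.halted, z, k, c⟩
  | predictor {z z' : Point n} {k c : ℕ} (h : ε < z.w.v0) (hstep : PredictorStep M q p τ z z') :
      Step M q p β τ ε ⟨.outer, z, k, c⟩ ⟨.inner, z', k + 1, 0⟩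
  | leave {z : Point n} {k c : ℕ} (h : z ∈ nbhdDelta M q β ∨ z.w.v0 = 0) :
      Step M q p β τ ε ⟨.inner, z, k, c⟩ ⟨.outer, z, k, c⟩
  | corrector {z z' : Point n} {k c : ℕ} (h : z ∉ nbhdDelta M q β) (h0 : z.w.v0 ≠ 0)
      (hstep : CorrectorStep M q z z') :
      Step M q p β τ ε ⟨.inner, z, k, c⟩ ⟨.inner, z', k, c + 1⟩

end PTS

end

noncomputable section

namespace PTS

section

theorem omega_pos {t : ℝ} (ht : 0 < t) : 0 < omega t := by
  have := Real.log_lt_sub_one_of_pos (x := 1 + t) (by linarith) (by linarith)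
  unfold omega; linarith

theorem omega_le_omega {a b : ℝ} (ha : 0 ≤ a) (hab : a ≤ b) : omega a ≤ omega b := by
  have ha' : 0 < 1 + a := by linarith
  have hb' : 0 < 1 + b := by linarith
  have h1 : Real.log ((1 + b) / (1 + a)) ≤ (1 + b) / (1 + a) - 1 :=
    Real.log_le_sub_one_of_pos (by positivity)
  rw [Real.log_div (by positivity) (by positivity)] at h1
  have h2 : (1 + b) / (1 + a) - 1 ≤ b - a := by
    rw [sub_le_iff_le_add, div_le_iff₀ (by positivity)]
    nlinarith
  unfold omega; linarith

theorem omegaStar_nonneg {t : ℝ} (ht : t < 1) : 0 ≤ omegaStar t := by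
  have := Real.log_le_sub_one_of_pos (x := 1 - t) (by linarith)
  unfold omegaStar; linarith

theorem hasSum_omegaStar {x : ℝ} (hx : |x| < 1) :
    HasSum (fun k : ℕ => x ^ (k + 2) / ((k : ℝ) + 2)) (omegaStar x) := by
  have h := Real.hasSum_pow_div_log_of_abs_lt_one hx
  have h2 := (hasSum_nat_add_iff' 1).mpr h
  have h3 : -Real.log (1 - x) - ∑ i ∈ Finset.range 1, x ^ (i + 1) / ((i : ℝ) + 1)
      = omegaStar x := by
    simp [omegaStar]
    ring
  rw [h3] at h2
  refine h2.congr_fun fun k => ?_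
  push_cast
  ring_nf

/-- The quotient `ω_*(x) / x²` is largest, among `|x| ≤ t`, at `x = t`. -/
theorem sq_mul_omegaStar_le {x t : ℝ} (hx : |x| ≤ t) (ht : t < 1) :
    t ^ 2 * omegaStar x ≤ x ^ 2 * omegaStar t := by
  have ht0 : 0 ≤ t := (abs_nonneg x).trans hx
  have h1 := (hasSum_omegaStar (hx.trans_lt ht)).mul_left (t ^ 2)
  have h2 := (hasSum_omegaStar (x := t) (by rwa [abs_of_nonneg ht0])).mul_left (x ^ 2)
  refine hasSum_le (fun k => ?_) h1 h2
  have h3 : x ^ k ≤ t ^ k := by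
    calc x ^ k ≤ |x ^ k| := le_abs_self _
      _ = |x| ^ k := abs_pow x k
      _ ≤ t ^ k := pow_le_pow_left₀ (abs_nonneg x) hx k
  have h4 : t ^ 2 * (x ^ (k + 2) / ((k : ℝ) + 2)) = x ^ 2 * t ^ 2 / ((k : ℝ) + 2) * x ^ k := by
    ring
  have h5 : x ^ 2 * (t ^ (k + 2) / ((k : ℝ) + 2)) = x ^ 2 * t ^ 2 / ((k : ℝ) + 2) * t ^ k := by
    ring
  rw [h4, h5]
  exact mul_le_mul_of_nonneg_left h3 (by positivity)

theorem abs_le_of_sum_sq_le {ι : Type*} [Fintype ι] {h : ι → ℝ} {t : ℝ} (ht : 0 ≤ t)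
    (hh : ∑ i, h i ^ 2 ≤ t ^ 2) (i : ι) : |h i| ≤ t :=
  abs_le_of_sq_le_sq ((Finset.single_le_sum (f := fun i => h i ^ 2) (fun _ _ => sq_nonneg _)
    (Finset.mem_univ i)).trans hh) ht

theorem neg_sum_log_le {ι : Type*} [Fintype ι] {h : ι → ℝ} {t : ℝ} (ht : 0 ≤ t) (ht1 : t < 1)
    (hh : ∑ i, h i ^ 2 ≤ t ^ 2) :
    -∑ i, Real.log (1 + h i) ≤ -∑ i, h i + omegaStar t := by
  have habs := abs_le_of_sum_sq_le ht hh
  rcases ht.eq_or_lt with rfl | htp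
  · have h0 : ∀ i, h i = 0 := fun i => abs_nonpos_iff.mp (habs i)
    simp [h0, omegaStar]
  · have h1 : ∀ i, t ^ 2 * omegaStar (-h i) ≤ h i ^ 2 * omegaStar t := fun i => by
      have := sq_mul_omegaStar_le (x := -h i) (by simpa using habs i) ht1
      simpa using this
    have h2 : t ^ 2 * ∑ i, omegaStar (-h i) ≤ t ^ 2 * omegaStar t := by
      rw [Finset.mul_sum]
      calc ∑ i, t ^ 2 * omegaStar (-h i) ≤ ∑ i, h i ^ 2 * omegaStar t :=
            Finset.sum_le_sum fun i _ => h1 i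
        _ = (∑ i, h i ^ 2) * omegaStar t := by rw [Finset.sum_mul]
        _ ≤ _ := mul_le_mul_of_nonneg_right hh (omegaStar_nonneg ht1)
    have h3 := le_of_mul_le_mul_left h2 (by positivity)
    have h4 : ∑ i, omegaStar (-h i) = ∑ i, h i - ∑ i, Real.log (1 + h i) := by
      rw [← Finset.sum_sub_distrib]
      exact Finset.sum_congr rfl fun i _ => by simp [omegaStar]
    linarith

/-- The decrease obtained by minimizing the model `-α g + ω_*(α η)` over `α`. -/
theorem neg_mul_add_omegaStar {g η : ℝ} (hg : 0 ≤ g) (hη : 0 < η) :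
    -(g / (η * (η + g)) * g) + omegaStar (g / (η * (η + g)) * η) = -omega (g / η) := by
  have h1 : 1 - g / (η * (η + g)) * η = (1 + g / η)⁻¹ := by
    field_simp
    ring
  unfold omegaStar omega
  rw [h1, Real.log_inv]
  field_simp
  ring

theorem euclNorm_sq {m : ℕ} (u : Fin m → ℝ) : euclNorm u ^ 2 = ∑ i, u i ^ 2 := by
  have h : 0 ≤ u ⬝ᵥ u := Finset.sum_nonneg fun i _ => mul_self_nonneg (u i)
  rw [euclNorm, Real.sq_sqrt h, dotProduct]
  exact Finset.sum_congr rfl fun i _ => (pow_two _).symm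

variable {n : ℕ}

theorem residual_zero (z : Point n) : residual z 0 = z.w.v0 - z.x ⬝ᵥ z.s := rfl

theorem residual_succ (z : Point n) (i : Fin n) :
    residual z i.succ = z.x i * z.s i - z.w.v i ^ 2 := rfl

theorem sum_residual (z : Point n) : ∑ i, residual z i = ((n : ℝ) + 1) * rho z.w := by
  have hn : (n : ℝ) + 1 ≠ 0 := by positivity
  rw [Fin.sum_univ_succ, rho, mul_div_cancel₀ _ hn]
  simp only [residual_zero, residual_succ, dotProduct, Finset.sum_sub_distrib, pow_two]
  ring

section Strict

variable {M : Matrix (Fin n) (Fin n) ℝ} {q : Fin n → ℝ} {z : Point n}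

theorem rho_pos (hr : ∀ i, 0 < residual z i) : 0 < rho z.w := by
  have h := sum_residual z
  have h2 : 0 < ∑ i, residual z i := Finset.sum_pos (fun i _ => hr i) Finset.univ_nonempty
  rw [h] at h2
  exact pos_of_mul_pos_right h2 (by positivity)

theorem sum_scaled (hr : ∀ i, 0 < residual z i) :
    ∑ i, (residual z i / rho z.w - 1) = 0 := by
  have := rho_pos hr
  rw [Finset.sum_sub_distrib, ← Finset.sum_div, sum_residual, mul_div_cancel_right₀ _ this.ne']
  simp

theorem rhat_sq (hr : ∀ i, 0 < residual z i) (i : Fin (n + 1)) :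
    rhat z i ^ 2 = residual z i / rho z.w :=
  Real.sq_sqrt (div_pos (hr i) (rho_pos hr)).le

theorem zeta0_sq (hr : ∀ i, 0 < residual z i) :
    zeta0 z ^ 2 = ∑ i, (residual z i / rho z.w - 1) ^ 2 / (residual z i / rho z.w) := by
  rw [zeta0, euclNorm_sq]
  refine Finset.sum_congr rfl fun i _ => ?_
  have h1 : 0 < rhat z i := Real.sqrt_pos.mpr (div_pos (hr i) (rho_pos hr))
  rw [← rhat_sq hr i]
  field_simp

theorem zeta1_sq (hr : ∀ i, 0 < residual z i) :
    zeta1 z ^ 2 = ∑ i, (1 / (residual z i / rho z.w) - 1) ^ 2 := by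
  rw [zeta1, euclNorm_sq]
  refine Finset.sum_congr rfl fun i _ => ?_
  rw [← rhat_sq hr i]

theorem zeta1_nonneg (z : Point n) : 0 ≤ zeta1 z := Real.sqrt_nonneg _

theorem abs_le_zeta1 (hr : ∀ i, 0 < residual z i) (i : Fin (n + 1)) :
    |1 / (residual z i / rho z.w) - 1| ≤ zeta1 z :=
  abs_le_of_sum_sq_le (zeta1_nonneg z) (zeta1_sq hr).ge i

theorem zeta0_sq_eq_sum (hr : ∀ i, 0 < residual z i) :
    zeta0 z ^ 2 = ∑ i, (1 / (residual z i / rho z.w) - 1) := by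
  have h : zeta0 z ^ 2 = ∑ i, (1 / (residual z i / rho z.w) - 1)
      + ∑ i, (residual z i / rho z.w - 1) := by
    rw [zeta0_sq hr, ← Finset.sum_add_distrib]
    refine Finset.sum_congr rfl fun i _ => ?_
    have := (div_pos (hr i) (rho_pos hr)).ne'
    generalize residual z i / rho z.w = y at *
    field_simp
    ring
  rw [h, sum_scaled hr, add_zero]

theorem delta_mul_zeta1 (hr : ∀ i, 0 < residual z i) : delta z * zeta1 z = zeta0 z ^ 2 := by
  unfold delta
  split_ifs with h
  · rw [zeta0_sq_eq_sum hr, zero_mul]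
    refine (Finset.sum_eq_zero fun i _ => ?_).symm
    have := abs_le_zeta1 hr i
    rw [h] at this
    exact abs_nonpos_iff.mp this
  · exact div_mul_cancel₀ _ h

theorem delta_nonneg (z : Point n) : 0 ≤ delta z := by
  unfold delta
  split_ifs
  · exact le_rfl
  · exact div_nonneg (sq_nonneg _) (zeta1_nonneg z)

theorem zeta1_le (hr : ∀ i, 0 < residual z i) : zeta1 z ≤ delta z * (1 + zeta1 z) := by
  have h1 : zeta1 z ^ 2 ≤ (1 + zeta1 z) * zeta0 z ^ 2 := by
    rw [zeta1_sq hr, zeta0_sq hr, Finset.mul_sum]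
    refine Finset.sum_le_sum fun i _ => ?_
    have hy := div_pos (hr i) (rho_pos hr)
    have hi := (abs_le.mp (abs_le_zeta1 hr i)).2
    generalize residual z i / rho z.w = y at *
    have h2 : (1 / y - 1) ^ 2 = 1 / y * ((y - 1) ^ 2 / y) := by field_simp; ring
    rw [h2]
    exact mul_le_mul_of_nonneg_right (by linarith) (by positivity)
  rcases (zeta1_nonneg z).eq_or_lt with h | h
  · rw [← h]; simp [delta_nonneg]
  · rw [← delta_mul_zeta1 hr] at h1
    nlinarith

theorem delta_le (hr : ∀ i, 0 < residual z i) : delta z ≤ zeta1 z * (1 + delta z) := by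
  have hd := delta_nonneg z
  rcases le_or_gt 1 (zeta1 z) with h | h
  · nlinarith
  have h1 : (1 - zeta1 z) * zeta0 z ^ 2 ≤ zeta1 z ^ 2 := by
    rw [zeta1_sq hr, zeta0_sq hr, Finset.mul_sum]
    refine Finset.sum_le_sum fun i _ => ?_
    have hy := div_pos (hr i) (rho_pos hr)
    have hi := (abs_le.mp (abs_le_zeta1 hr i)).1
    generalize residual z i / rho z.w = y at *
    have h2 : (1 / y - 1) ^ 2 = 1 / y * ((y - 1) ^ 2 / y) := by field_simp; ring
    rw [h2]
    exact mul_le_mul_of_nonneg_right (by linarith) (by positivity)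
  rcases (zeta1_nonneg z).eq_or_lt with h0 | h0
  · unfold delta; simp [← h0]
  · rw [← delta_mul_zeta1 hr] at h1
    nlinarith

end Strict

end

section

variable {n : ℕ}

theorem exists_isDirection {M : Matrix (Fin n) (Fin n) ℝ} (hM : IsMonotoneMatrix M)
    {z : Point n} (hx : ∀ i, 0 < z.x i) (hs : ∀ i, 0 < z.s i) (a : Fin n → ℝ) :
    ∃ dx ds, IsDirection M z a dx ds := by
  let L : (Fin n → ℝ) →ₗ[ℝ] (Fin n → ℝ) :=
    { toFun := fun u i => z.s i * u i + z.x i * (M *ᵥ u) i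
      map_add' := fun u v => by
        funext i
        simp only [mulVec_add, Pi.add_apply]
        ring
      map_smul' := fun c u => by
        funext i
        simp only [mulVec_smul, Pi.smul_apply, smul_eq_mul, RingHom.id_apply]
        ring }
  have hinj : Function.Injective L := by
    rw [← LinearMap.ker_eq_bot, LinearMap.ker_eq_bot']
    intro u hu
    have hu' : ∀ i, z.s i * u i + z.x i * (M *ᵥ u) i = 0 := fun i => congrFun hu i
    have h1 : ∀ i, u i * (M *ᵥ u) i = -(z.s i / z.x i * u i ^ 2) := fun i => by
      have := (hx i).ne'
      have h2 : (M *ᵥ u) i = -(z.s i * u i / z.x i) := by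
        field_simp
        linarith [hu' i]
      rw [h2]
      ring
    have h3 : ∑ i, z.s i / z.x i * u i ^ 2 ≤ 0 := by
      have := hM u
      simp only [dotProduct, h1, Finset.sum_neg_distrib] at this
      linarith
    have h4 : ∀ i ∈ Finset.univ, 0 ≤ z.s i / z.x i * u i ^ 2 := fun i _ =>
      mul_nonneg (div_pos (hs i) (hx i)).le (sq_nonneg _)
    have h5 := (Finset.sum_eq_zero_iff_of_nonneg h4).mp (le_antisymm h3 (Finset.sum_nonneg h4))
    funext i
    rcases mul_eq_zero.mp (h5 i (Finset.mem_univ i)) with h | h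
    · exact absurd h (div_pos (hs i) (hx i)).ne'
    · exact pow_eq_zero_iff (two_ne_zero) |>.mp h
  obtain ⟨u, hu⟩ := (LinearMap.injective_iff_surjective.mp hinj) a
  exact ⟨u, M *ᵥ u, by simp, fun i => congrFun hu i⟩

section Direction

variable {M : Matrix (Fin n) (Fin n) ℝ} {q : Fin n → ℝ} {z : Point n} {a dx ds : Fin n → ℝ}

/-- The second-order coefficients of the residuals along a direction. -/
def curvature (dx ds : Fin n → ℝ) : Fin (n + 1) → ℝ :=
  Fin.cons (-(dx ⬝ᵥ ds)) fun i => dx i * ds i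

theorem sum_curvature (dx ds : Fin n → ℝ) : ∑ i, curvature dx ds i = 0 := by
  simp [Fin.sum_univ_succ, curvature, dotProduct]

theorem IsDirection.dotProduct_nonneg (hM : IsMonotoneMatrix M) (h : IsDirection M z a dx ds) :
    0 ≤ dx ⬝ᵥ ds := by
  have h1 : ds = M *ᵥ dx := by
    have := h.1
    rwa [neg_add_eq_zero, eq_comm] at this
  rw [h1]
  exact hM dx

theorem IsDirection.four_mul_le (h : IsDirection M z a dx ds) (i : Fin n) :
    4 * (z.x i * z.s i) * (dx i * ds i) ≤ a i ^ 2 := by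
  rw [← h.2 i]
  nlinarith [sq_nonneg (z.s i * dx i - z.x i * ds i)]

theorem IsDirection.sum_abs_curvature_le (hM : IsMonotoneMatrix M)
    (h : IsDirection M z a dx ds) (hx : ∀ i, 0 < z.x i) (hs : ∀ i, 0 < z.s i) :
    ∑ i, |curvature dx ds i| ≤ ∑ i, a i ^ 2 / (2 * (z.x i * z.s i)) := by
  have h0 : ∑ i, |curvature dx ds i| = ∑ i, (|curvature dx ds i| + curvature dx ds i) := by
    rw [Finset.sum_add_distrib, sum_curvature, add_zero]
  rw [h0, Fin.sum_univ_succ]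
  have h1 : curvature dx ds 0 ≤ 0 := by
    simpa [curvature] using h.dotProduct_nonneg hM
  rw [abs_of_nonpos h1, neg_add_cancel, zero_add]
  refine Finset.sum_le_sum fun i _ => ?_
  have hp := mul_pos (hx i) (hs i)
  have h2 : curvature dx ds i.succ = dx i * ds i := rfl
  rw [h2]
  rcases abs_cases (dx i * ds i) with ⟨h3, -⟩ | ⟨h3, -⟩
  · rw [h3, le_div_iff₀ (by positivity)]
    nlinarith [h.four_mul_le i]
  · rw [h3, neg_add_cancel]
    positivity

theorem IsDirection.mem_affine (h : IsDirection M z a dx ds) (hz : -(M *ᵥ z.x) + z.s = q)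
    (t : ℝ) : -(M *ᵥ (z.x + t • dx)) + (z.s + t • ds) = q := by
  have h1 := h.1
  rw [mulVec_add, mulVec_smul]
  calc _ = (-(M *ᵥ z.x) + z.s) + t • (-(M *ᵥ dx) + ds) := by
        rw [smul_add, smul_neg]; abel
    _ = q := by rw [h1, hz, smul_zero, add_zero]

/-- The complementarity products along a direction. -/
theorem IsDirection.mul_eq (h : IsDirection M z a dx ds) (t : ℝ) (i : Fin n) :
    (z.x + t • dx) i * (z.s + t • ds) i
      = z.x i * z.s i + t * a i + t ^ 2 * (dx i * ds i) := by
  rw [← h.2 i]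
  simp only [Pi.add_apply, Pi.smul_apply, smul_eq_mul]
  ring

theorem IsDirection.dotProduct_eq (h : IsDirection M z a dx ds) (t : ℝ) :
    (z.x + t • dx) ⬝ᵥ (z.s + t • ds)
      = z.x ⬝ᵥ z.s + t * ∑ i, a i + t ^ 2 * (dx ⬝ᵥ ds) := by
  simp only [dotProduct, h.mul_eq, Finset.sum_add_distrib, Finset.mul_sum]

/-- If `x, s > 0`, a positive product `x' s'` with `s x' + x s' > 0` has positive factors. -/
theorem pos_of_mul_pos_of_add_pos {x s x' s' : ℝ} (hx : 0 < x) (hs : 0 < s) (h : 0 < x' * s')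
    (h' : 0 < s * x' + x * s') : 0 < x' ∧ 0 < s' := by
  rcases mul_pos_iff.mp h with h1 | h1
  · exact h1
  · nlinarith [mul_neg_of_pos_of_neg hs h1.1, mul_neg_of_pos_of_neg hx h1.2]

theorem IsDirection.strictlyFeasible (h : IsDirection M z a dx ds)
    (hz : (z.x, z.s) ∈ strictlyFeasible M q) {t : ℝ}
    (h1 : ∀ i, 0 < (z.x + t • dx) i * (z.s + t • ds) i)
    (h2 : ∀ i, 0 < 2 * (z.x i * z.s i) + t * a i) :
    (z.x + t • dx, z.s + t • ds) ∈ PTS.strictlyFeasible M q := by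
  obtain ⟨hz1, hx, hs⟩ := hz
  have h3 : ∀ i, 0 < (z.x + t • dx) i ∧ 0 < (z.s + t • ds) i := fun i => by
    refine pos_of_mul_pos_of_add_pos (hx i) (hs i) (h1 i) ?_
    have := h2 i
    rw [← h.2 i] at this
    simp only [Pi.add_apply, Pi.smul_apply, smul_eq_mul]
    nlinarith
  exact ⟨h.mem_affine hz1 t, fun i => (h3 i).1, fun i => (h3 i).2⟩

theorem residual_correctorPoint (h : IsDirection M z (rhsCorrector z) dx ds) (t : ℝ)
    (i : Fin (n + 1)) :
    residual (correctorPoint z dx ds t) i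
      = residual z i + t * (rho z.w - residual z i) + t ^ 2 * curvature dx ds i := by
  refine Fin.cases ?_ (fun i => ?_) i
  · have h1 := h.dotProduct_eq t
    have h2 : ∑ i, rhsCorrector z i = -(rho z.w - residual z 0) := by
      have h3 := sum_residual z
      rw [Fin.sum_univ_succ] at h3
      have h4 : ∑ i, rhsCorrector z i = ∑ i : Fin n, (rho z.w - residual z i.succ) :=
        Finset.sum_congr rfl fun i _ => by rw [rhsCorrector, residual_succ]; ring
      rw [h4, Finset.sum_sub_distrib]
      simp
      linarith
    rw [h2] at h1
    have h5 : residual (correctorPoint z dx ds t) 0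
      = z.w.v0 - (z.x + t • dx) ⬝ᵥ (z.s + t • ds) := rfl
    have h6 : curvature dx ds 0 = -(dx ⬝ᵥ ds) := rfl
    rw [h5, h1, residual_zero, h6]
    ring
  · have h1 := h.mul_eq t i
    have h5 : residual (correctorPoint z dx ds t) i.succ
      = (z.x + t • dx) i * (z.s + t • ds) i - z.w.v i ^ 2 := rfl
    have h6 : curvature dx ds i.succ = dx i * ds i := rfl
    rw [h5, h1, residual_succ, h6, rhsCorrector]
    ring

/-- Along the corrector direction each residual is a product of two real linear factors. -/
theorem discrim_nonneg (hM : IsMonotoneMatrix M) (h : IsDirection M z (rhsCorrector z) dx ds)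
    (hr : ∀ i, 0 < residual z i) (i : Fin (n + 1)) :
    4 * residual z i * curvature dx ds i ≤ (rho z.w - residual z i) ^ 2 := by
  have hri := hr i
  rcases le_or_gt (curvature dx ds i) 0 with hd | hd
  · nlinarith [sq_nonneg (rho z.w - residual z i)]
  revert hd hri
  refine Fin.cases ?_ (fun i => ?_) i
  · intro _ hd
    have h6 : curvature dx ds 0 = -(dx ⬝ᵥ ds) := rfl
    rw [h6] at hd
    linarith [h.dotProduct_nonneg hM]
  · intro _ hd
    have h6 : curvature dx ds i.succ = dx i * ds i := rfl
    have h7 := h.four_mul_le i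
    rw [h6] at hd ⊢
    have h8 : rhsCorrector z i = rho z.w - residual z i.succ := by
      rw [rhsCorrector, residual_succ]; ring
    rw [h8] at h7
    refine le_trans ?_ h7
    have : residual z i.succ ≤ z.x i * z.s i := by
      rw [residual_succ]; linarith [sq_nonneg (z.w.v i)]
    nlinarith

theorem exists_factor {r b d : ℝ} (hr : 0 < r) (h : 4 * r * d ≤ b ^ 2) :
    ∃ l m : ℝ, (∀ t, r + t * b + t ^ 2 * d = r * ((1 + t * l) * (1 + t * m))) ∧
      l + m = b / r ∧ l ^ 2 + m ^ 2 = (b / r) ^ 2 - 2 * (d / r) := by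
  have h0 : 0 ≤ b ^ 2 - 4 * r * d := by linarith
  have hs := Real.sq_sqrt h0
  set w := Real.sqrt (b ^ 2 - 4 * r * d)
  have h1 : (b + w) / (2 * r) * ((b - w) / (2 * r)) = d / r := by
    field_simp
    nlinarith
  have h2 : (b + w) / (2 * r) + (b - w) / (2 * r) = b / r := by
    field_simp
    ring
  refine ⟨(b + w) / (2 * r), (b - w) / (2 * r), fun t => ?_, h2, ?_⟩
  · have h3 : r * ((1 + t * ((b + w) / (2 * r))) * (1 + t * ((b - w) / (2 * r))))
      = r * (1 + t * ((b + w) / (2 * r) + (b - w) / (2 * r))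
        + t ^ 2 * ((b + w) / (2 * r) * ((b - w) / (2 * r)))) := by ring
    rw [h3, h1, h2]
    field_simp
  · have h3 : ((b + w) / (2 * r)) ^ 2 + ((b - w) / (2 * r)) ^ 2
      = ((b + w) / (2 * r) + (b - w) / (2 * r)) ^ 2
        - 2 * ((b + w) / (2 * r) * ((b - w) / (2 * r))) := by ring
    rw [h3, h1, h2]

/-- The second derivative of the barrier along the corrector direction is at most
`(1 + δ) ζ₁²`. -/
theorem barrier_second_derivative_le (hM : IsMonotoneMatrix M)
    (h : IsDirection M z (rhsCorrector z) dx ds) (hz : z ∈ strictSet M q) :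
    ∑ i, (((rho z.w - residual z i) / residual z i) ^ 2
      - 2 * (curvature dx ds i / residual z i)) ≤ (1 + delta z) * zeta1 z ^ 2 := by
  obtain ⟨⟨-, hx, hs⟩, hr⟩ := hz
  have hρ := rho_pos hr
  have h1 : ∑ i, |curvature dx ds i| ≤ rho z.w * zeta0 z ^ 2 / 2 := by
    refine (h.sum_abs_curvature_le hM hx hs).trans ?_
    rw [zeta0_sq hr, Fin.sum_univ_succ]
    have h2 : 0 ≤ (residual z 0 / rho z.w - 1) ^ 2 / (residual z 0 / rho z.w) :=
      div_nonneg (sq_nonneg _) (div_pos (hr 0) hρ).le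
    have h3 : ∑ i, rhsCorrector z i ^ 2 / (2 * (z.x i * z.s i)) ≤ rho z.w *
        (∑ i : Fin n, (residual z i.succ / rho z.w - 1) ^ 2 / (residual z i.succ / rho z.w)) / 2 := by
      rw [Finset.mul_sum, Finset.sum_div]
      refine Finset.sum_le_sum fun i _ => ?_
      have h8 : rhsCorrector z i = rho z.w - residual z i.succ := by
        rw [rhsCorrector, residual_succ]; ring
      have h9 : residual z i.succ ≤ z.x i * z.s i := by
        rw [residual_succ]; linarith [sq_nonneg (z.w.v i)]
      have hri := hr i.succ
      rw [h8]
      generalize residual z i.succ = r at *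
      generalize rho z.w = ρ at *
      have h10 : ρ * ((r / ρ - 1) ^ 2 / (r / ρ)) / 2 = (ρ - r) ^ 2 / (2 * r) := by
        field_simp
        ring
      rw [h10]
      exact div_le_div_of_nonneg_left (sq_nonneg _) (by positivity) (by linarith)
    nlinarith
  have h2 : ∀ i, ((rho z.w - residual z i) / residual z i) ^ 2
      - 2 * (curvature dx ds i / residual z i) ≤ (1 / (residual z i / rho z.w) - 1) ^ 2
        + 2 * zeta1 z / rho z.w * |curvature dx ds i| - 2 / rho z.w * curvature dx ds i := by
    intro i
    have h3 := abs_le_zeta1 hr i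
    have hri := hr i
    generalize curvature dx ds i = d at *
    have h4 : (rho z.w - residual z i) / residual z i = 1 / (residual z i / rho z.w) - 1 := by
      field_simp
    have h5 : d / residual z i = (1 / (residual z i / rho z.w) - 1) * (d / rho z.w)
        + d / rho z.w := by
      field_simp
      ring
    rw [h4, h5]
    generalize 1 / (residual z i / rho z.w) - 1 = u at *
    have h6 : -(u * (d / rho z.w)) ≤ zeta1 z * (|d| / rho z.w) := by
      calc -(u * (d / rho z.w)) ≤ |u * (d / rho z.w)| := neg_le_abs _
        _ = |u| * (|d| / rho z.w) := by rw [abs_mul, abs_div, abs_of_pos hρ]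
        _ ≤ _ := mul_le_mul_of_nonneg_right h3 (by positivity)
    have h7 : 2 * zeta1 z / rho z.w * |d| = 2 * (zeta1 z * (|d| / rho z.w)) := by ring
    have h8 : 2 / rho z.w * d = 2 * (d / rho z.w) := by ring
    rw [h7, h8]
    linarith
  refine (Finset.sum_le_sum fun i _ => h2 i).trans ?_
  rw [Finset.sum_sub_distrib, Finset.sum_add_distrib, ← Finset.mul_sum, ← Finset.mul_sum,
    sum_curvature, ← zeta1_sq hr]
  have h3 : 2 * zeta1 z / rho z.w * ∑ i, |curvature dx ds i| ≤ zeta1 z * zeta0 z ^ 2 := by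
    have h4 := mul_le_mul_of_nonneg_left h1
      (div_nonneg (mul_nonneg zero_le_two (zeta1_nonneg z)) hρ.le)
    refine h4.trans (le_of_eq ?_)
    field_simp
  rw [← delta_mul_zeta1 hr] at h3
  linarith

/-- Some step length in `[0, 1]` along the corrector direction decreases the barrier by
`ω (δ / √(1 + 2 δ))`. -/
theorem exists_corrector_decrease (hM : IsMonotoneMatrix M)
    (h : IsDirection M z (rhsCorrector z) dx ds) (hz : z ∈ strictSet M q) (hδ : 0 < delta z) :
    ∃ t ∈ Set.Icc (0 : ℝ) 1, correctorPoint z dx ds t ∈ strictSet M q ∧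
      barrier (correctorPoint z dx ds t)
        ≤ barrier z - omega (delta z / Real.sqrt (1 + 2 * delta z)) := by
  have hsd := barrier_second_derivative_le hM h hz
  obtain ⟨hz1, hr⟩ := hz
  have hρ := rho_pos hr
  choose l m hlm hsum hsq using fun i => exists_factor (hr i) (discrim_nonneg hM h hr i)
  have hζ : 0 < zeta1 z := by
    rcases (zeta1_nonneg z).eq_or_lt with h0 | h0
    · rw [delta, if_pos h0.symm] at hδ
      exact absurd hδ (lt_irrefl _)
    · exact h0
  set k := Real.sqrt (1 + 2 * delta z) with hk
  have hk2 : k ^ 2 = 1 + 2 * delta z := Real.sq_sqrt (by linarith)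
  have hk1 : 1 ≤ k := by
    rw [hk, Real.one_le_sqrt]; linarith
  set η := k * zeta1 z with hη
  have hηp : 0 < η := by positivity
  set g := delta z * zeta1 z with hg
  have hgp : 0 < g := by positivity
  set t := g / (η * (η + g)) with ht
  have htp : 0 < t := by positivity
  have ht1 : t ≤ 1 := by
    rw [ht, div_le_one (by positivity)]
    have h1 := delta_le hr
    have h2 : g ≤ zeta1 z ^ 2 * (1 + delta z) := by rw [hg]; nlinarith
    have h3 : zeta1 z ^ 2 * (1 + delta z) ≤ η * η := by
      have : η * η = zeta1 z ^ 2 * (1 + 2 * delta z) := by rw [hη, ← hk2]; ring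
      rw [this]
      exact mul_le_mul_of_nonneg_left (by linarith) (sq_nonneg _)
    nlinarith
  have htη : t * η < 1 := by
    have : t * η = g / (η + g) := by rw [ht]; field_simp
    rw [this, div_lt_one (by positivity)]
    linarith
  let f : Fin (n + 1) ⊕ Fin (n + 1) → ℝ := Sum.elim (fun i => t * l i) (fun i => t * m i)
  have hf : ∑ j, f j ^ 2 ≤ (t * η) ^ 2 := by
    have h1 : ∑ j, f j ^ 2 = t ^ 2 * ∑ i, (l i ^ 2 + m i ^ 2) := by
      rw [Fintype.sum_sum_type, ← Finset.sum_add_distrib, Finset.mul_sum]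
      exact Finset.sum_congr rfl fun i _ => by simp only [f, Sum.elim_inl, Sum.elim_inr]; ring
    rw [h1, mul_pow]
    refine mul_le_mul_of_nonneg_left ?_ (sq_nonneg _)
    simp only [hsq]
    refine hsd.trans ?_
    rw [hη, mul_pow, hk2]
    exact mul_le_mul_of_nonneg_right (by linarith) (sq_nonneg _)
  have habs := abs_le_of_sum_sq_le (by positivity) hf
  have hlog := neg_sum_log_le (by positivity) htη hf
  have hl : ∀ i, 0 < 1 + t * l i := fun i => by
    have := (abs_le.mp (habs (Sum.inl i))).1
    simp only [f, Sum.elim_inl] at this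
    linarith
  have hm : ∀ i, 0 < 1 + t * m i := fun i => by
    have := (abs_le.mp (habs (Sum.inr i))).1
    simp only [f, Sum.elim_inr] at this
    linarith
  have hres : ∀ i, residual (correctorPoint z dx ds t) i
      = residual z i * ((1 + t * l i) * (1 + t * m i)) := fun i => by
    rw [residual_correctorPoint h, hlm]
  have hpos : ∀ i, 0 < residual (correctorPoint z dx ds t) i := fun i => by
    rw [hres]
    exact mul_pos (hr i) (mul_pos (hl i) (hm i))
  refine ⟨t, ⟨htp.le, ht1⟩, ⟨h.strictlyFeasible hz1 (fun i => ?_) fun i => ?_, hpos⟩, ?_⟩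
  · have h1 := hpos i.succ
    have h2 : residual (correctorPoint z dx ds t) i.succ
      = (z.x + t • dx) i * (z.s + t • ds) i - z.w.v i ^ 2 := rfl
    rw [h2] at h1
    linarith [sq_nonneg (z.w.v i)]
  · have h1 := hr i.succ
    rw [residual_succ] at h1
    rw [rhsCorrector]
    have h2 := sq_nonneg (z.w.v i)
    have h3 := mul_pos htp hρ
    nlinarith
  · have h1 : barrier (correctorPoint z dx ds t) = barrier z - ∑ j, Real.log (1 + f j) := by
      rw [Fintype.sum_sum_type, ← Finset.sum_add_distrib, barrier, barrier,
        sub_eq_add_neg, ← neg_add, ← Finset.sum_add_distrib]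
      congr 1
      refine Finset.sum_congr rfl fun i _ => ?_
      rw [hres, Real.log_mul (hr i).ne' (mul_pos (hl i) (hm i)).ne',
        Real.log_mul (hl i).ne' (hm i).ne']
      simp only [f, Sum.elim_inl, Sum.elim_inr]
    have h2 : ∑ j, f j = t * g := by
      rw [Fintype.sum_sum_type, ← Finset.sum_add_distrib, hg, delta_mul_zeta1 hr,
        zeta0_sq_eq_sum hr, Finset.mul_sum]
      refine Finset.sum_congr rfl fun i _ => ?_
      simp only [f, Sum.elim_inl, Sum.elim_inr]
      rw [← mul_add, hsum]
      have := (hr i).ne'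
      field_simp
    have h3 := neg_mul_add_omegaStar hgp.le hηp
    have h4 : g / η = delta z / k := by rw [hg, hη]; field_simp
    rw [h4] at h3
    rw [h1]
    linarith

theorem div_sqrt_le {a b : ℝ} (ha : 0 ≤ a) (hab : a ≤ b) :
    a / Real.sqrt (1 + 2 * a) ≤ b / Real.sqrt (1 + 2 * b) := by
  have h1 : 0 < Real.sqrt (1 + 2 * a) := Real.sqrt_pos.mpr (by linarith)
  have h2 : 0 < Real.sqrt (1 + 2 * b) := Real.sqrt_pos.mpr (by linarith)
  rw [div_le_div_iff₀ h1 h2]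
  refine abs_le_of_sq_le_sq' ?_ (mul_nonneg (ha.trans hab) h1.le) |>.2
  rw [mul_pow, mul_pow, Real.sq_sqrt (by linarith), Real.sq_sqrt (by linarith)]
  nlinarith [mul_nonneg ha (sub_nonneg.mpr hab), mul_nonneg (ha.trans hab) (sub_nonneg.mpr hab),
    mul_nonneg (mul_nonneg ha (ha.trans hab)) (sub_nonneg.mpr hab)]

end Direction

end

section

variable {n : ℕ} {M : Matrix (Fin n) (Fin n) ℝ} {q : Fin n → ℝ} {z : Point n}

theorem continuous_residual {X : Type*} [TopologicalSpace X] {x s v : X → Fin n → ℝ} {v0 : X → ℝ}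
    (hx : Continuous x) (hs : Continuous s) (hv : Continuous v) (hv0 : Continuous v0)
    (i : Fin (n + 1)) :
    Continuous fun y => residual ⟨x y, s y, ⟨v0 y, v y⟩⟩ i := by
  refine Fin.cases ?_ (fun i => ?_) i
  · simp only [residual_zero]
    exact hv0.sub (hx.dotProduct hs)
  · simp only [residual_succ]
    fun_prop

theorem barrier_eq_neg_log_prod (hr : ∀ i, 0 < residual z i) :
    barrier z = -Real.log (∏ i, residual z i) := by
  rw [barrier, Real.log_prod fun i _ => (hr i).ne']

theorem mem_strictSet_of_prod_pos (hz : (z.x, z.s) ∈ feasible M q) (hr : ∀ i, 0 ≤ residual z i)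
    (hp : 0 < ∏ i, residual z i) : z ∈ strictSet M q := by
  have hr' : ∀ i, 0 < residual z i := fun i =>
    (hr i).lt_of_ne fun h => hp.ne' (Finset.prod_eq_zero (Finset.mem_univ i) h.symm)
  have hxs : ∀ i, 0 < z.x i * z.s i := fun i => by
    have := hr' i.succ
    rw [residual_succ] at this
    linarith [sq_nonneg (z.w.v i)]
  exact ⟨⟨hz.1, fun i => pos_of_mul_pos_left (hxs i) (hz.2.2 i),
    fun i => pos_of_mul_pos_right (hxs i) (hz.2.1 i)⟩, hr'⟩

theorem isCompact_feasible_residual (hM : IsMonotoneMatrix M)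
    (hz : z ∈ strictSet M q) :
    IsCompact {y : (Fin n → ℝ) × (Fin n → ℝ) |
      y ∈ feasible M q ∧ ∀ i, 0 ≤ residual ⟨y.1, y.2, z.w⟩ i} := by
  obtain ⟨⟨hz1, hx, hs⟩, hr⟩ := hz
  have hsub : {y : (Fin n → ℝ) × (Fin n → ℝ) |
      y ∈ feasible M q ∧ ∀ i, 0 ≤ residual ⟨y.1, y.2, z.w⟩ i} ⊆
      Set.Icc ((0, 0) : (Fin n → ℝ) × (Fin n → ℝ))
        (fun i => 2 * z.w.v0 / z.s i, fun i => 2 * z.w.v0 / z.x i) := by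
    rintro ⟨x, s⟩ ⟨⟨h1, h2, h3⟩, h4⟩
    simp only at h1 h2 h3 h4
    have h5 : s - z.s = M *ᵥ (x - z.x) := by
      rw [mulVec_sub, ← sub_eq_zero]
      have : s - z.s - (M *ᵥ x - M *ᵥ z.x) = (-(M *ᵥ x) + s) - (-(M *ᵥ z.x) + z.s) := by abel
      rw [this, h1, hz1, sub_self]
    have h6 := hM (x - z.x)
    rw [← h5, sub_dotProduct, dotProduct_sub, dotProduct_sub] at h6
    have h7 := h4 0
    have h8 := hr 0
    simp only [residual_zero] at h7 h8
    have h9 : x ⬝ᵥ z.s + z.x ⬝ᵥ s ≤ 2 * z.w.v0 := by linarith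
    have h10 : 0 ≤ x ⬝ᵥ z.s := Finset.sum_nonneg fun i _ => mul_nonneg (h2 i) (hs i).le
    have h11 : 0 ≤ z.x ⬝ᵥ s := Finset.sum_nonneg fun i _ => mul_nonneg (hx i).le (h3 i)
    refine ⟨⟨h2, h3⟩, fun i => ?_, fun i => ?_⟩
    · have : x i * z.s i ≤ x ⬝ᵥ z.s := Finset.single_le_sum (f := fun i => x i * z.s i)
        (fun i _ => mul_nonneg (h2 i) (hs i).le) (Finset.mem_univ i)
      change x i ≤ 2 * z.w.v0 / z.s i
      rw [le_div_iff₀ (hs i)]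
      linarith
    · have : z.x i * s i ≤ z.x ⬝ᵥ s := Finset.single_le_sum (f := fun i => z.x i * s i)
        (fun i _ => mul_nonneg (hx i).le (h3 i)) (Finset.mem_univ i)
      change s i ≤ 2 * z.w.v0 / z.x i
      rw [le_div_iff₀ (hx i)]
      linarith
  refine isCompact_Icc.of_isClosed_subset ?_ hsub
  have hc : ∀ i, Continuous fun y : (Fin n → ℝ) × (Fin n → ℝ) => residual ⟨y.1, y.2, z.w⟩ i :=
    fun i => continuous_residual continuous_fst continuous_snd continuous_const continuous_const i
  have hf : IsClosed (feasible M q) := by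
    unfold feasible
    simp only [Set.ofPred_and, Set.ofPred_forall]
    refine IsClosed.inter (isClosed_eq ?_ continuous_const) (IsClosed.inter ?_ ?_)
    · exact (continuous_const.matrix_mulVec continuous_fst).neg.add continuous_snd
    · exact isClosed_iInter fun i => isClosed_le continuous_const (by fun_prop)
    · exact isClosed_iInter fun i => isClosed_le continuous_const (by fun_prop)
  simp only [Set.ofPred_and, Set.ofPred_forall]
  exact hf.inter (isClosed_iInter fun i => isClosed_le continuous_const (hc i))

theorem strictSet_feasible (hz : z ∈ strictSet M q) : (z.x, z.s) ∈ feasible M q :=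
  ⟨hz.1.1, fun i => (hz.1.2.1 i).le, fun i => (hz.1.2.2 i).le⟩

theorem barrier_eq (hr : ∀ i, 0 < residual z i) :
    barrier z = -∑ i, Real.log (residual z i / rho z.w) - ((n : ℝ) + 1) * Real.log (rho z.w) := by
  have h : ∀ i, Real.log (residual z i / rho z.w)
      = Real.log (residual z i) - Real.log (rho z.w) := fun i =>
    Real.log_div (hr i).ne' (rho_pos hr).ne'
  simp only [h, Finset.sum_sub_distrib, barrier]
  simp

theorem neg_mul_log_rho_le_barrier (hr : ∀ i, 0 < residual z i) :
    -(((n : ℝ) + 1) * Real.log (rho z.w)) ≤ barrier z := by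
  rw [barrier_eq hr]
  have h : ∑ i, Real.log (residual z i / rho z.w) ≤ ∑ i, (residual z i / rho z.w - 1) :=
    Finset.sum_le_sum fun i _ => Real.log_le_sub_one_of_pos (div_pos (hr i) (rho_pos hr))
  rw [sum_scaled hr] at h
  linarith

/-- The weighted center: as soon as some point has target `w`, there is one whose residuals
are all equal to `ρ(w)`. -/
theorem exists_center (hM : IsMonotoneMatrix M) (hz : z ∈ strictSet M q) :
    ∃ x s, (⟨x, s, z.w⟩ : Point n) ∈ strictSet M q ∧
      ∀ i, residual ⟨x, s, z.w⟩ i = rho z.w := by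
  have hc : Continuous fun y : (Fin n → ℝ) × (Fin n → ℝ) =>
      ∏ i, residual ⟨y.1, y.2, z.w⟩ i :=
    continuous_finsetProd _ fun i _ =>
      continuous_residual continuous_fst continuous_snd continuous_const continuous_const i
  obtain ⟨⟨x, s⟩, ⟨h1, h2⟩, h3⟩ := (isCompact_feasible_residual hM hz).exists_isMaxOn
    ⟨(z.x, z.s), strictSet_feasible hz, fun i => (hz.2 i).le⟩ hc.continuousOn
  rw [isMaxOn_iff] at h3
  have hp : 0 < ∏ i, residual ⟨x, s, z.w⟩ i := by
    have h4 : ∏ i, residual z i ≤ ∏ i, residual ⟨x, s, z.w⟩ i :=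
      h3 (z.x, z.s) ⟨strictSet_feasible hz, fun i => (hz.2 i).le⟩
    exact (Finset.prod_pos fun i _ => hz.2 i).trans_le h4
  have hmem : (⟨x, s, z.w⟩ : Point n) ∈ strictSet M q := mem_strictSet_of_prod_pos h1 h2 hp
  refine ⟨x, s, hmem, ?_⟩
  have hδ : delta (⟨x, s, z.w⟩ : Point n) = 0 := by
    by_contra hne
    have hδ := (delta_nonneg _).lt_of_ne' hne
    obtain ⟨dx, ds, hd⟩ := exists_isDirection (z := ⟨x, s, z.w⟩) hM hmem.1.2.1 hmem.1.2.2
      (rhsCorrector (⟨x, s, z.w⟩ : Point n))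
    obtain ⟨t, -, ht1, ht2⟩ := exists_corrector_decrease hM hd hmem hδ
    have h5 : ∏ i, residual (correctorPoint ⟨x, s, z.w⟩ dx ds t) i
        ≤ ∏ i, residual ⟨x, s, z.w⟩ i :=
      h3 (x + t • dx, s + t • ds) ⟨strictSet_feasible ht1, fun i => (ht1.2 i).le⟩
    have h6 := Real.log_le_log (Finset.prod_pos fun i _ => ht1.2 i) h5
    rw [barrier_eq_neg_log_prod ht1.2, barrier_eq_neg_log_prod hmem.2] at ht2
    have h7 : 0 < omega (delta (⟨x, s, z.w⟩ : Point n)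
        / Real.sqrt (1 + 2 * delta (⟨x, s, z.w⟩ : Point n))) :=
      omega_pos (div_pos hδ (Real.sqrt_pos.mpr (by linarith)))
    linarith
  have hζ : zeta1 (⟨x, s, z.w⟩ : Point n) = 0 := by
    have := zeta1_le hmem.2
    rw [hδ, zero_mul] at this
    exact le_antisymm this (zeta1_nonneg _)
  intro i
  have h4 := abs_le_zeta1 hmem.2 i
  rw [hζ, abs_nonpos_iff, sub_eq_zero] at h4
  have := (hmem.2 i).ne'
  have := (rho_pos hmem.2).ne'
  field_simp at h4
  exact h4.symm

theorem controlBarrier_eq (hM : IsMonotoneMatrix M) (hz : z ∈ strictSet M q) :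
    controlBarrier M q z.w = -(((n : ℝ) + 1) * Real.log (rho z.w)) := by
  obtain ⟨x, s, h1, h2⟩ := exists_center hM hz
  refine IsLeast.csInf_eq ⟨⟨x, s, h1, ?_⟩, ?_⟩
  · simp [barrier, h2]
  · rintro t ⟨x', s', h3, rfl⟩
    exact neg_mul_log_rho_le_barrier h3.2

theorem Psi_eq (hM : IsMonotoneMatrix M) (hz : z ∈ strictSet M q) :
    Psi M q z = -∑ i, Real.log (residual z i / rho z.w) := by
  rw [Psi, controlBarrier_eq hM hz, barrier_eq hz.2]
  ring

theorem Psi_nonneg (hM : IsMonotoneMatrix M) (hz : z ∈ strictSet M q) : 0 ≤ Psi M q z := by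
  rw [Psi, controlBarrier_eq hM hz]
  linarith [neg_mul_log_rho_le_barrier hz.2]

theorem Psi_le_iff (hM : IsMonotoneMatrix M) (hz : z ∈ strictSet M q) (τ : ℝ) :
    Psi M q z ≤ τ ↔ Real.exp (-τ) * rho z.w ^ (n + 1) ≤ ∏ i, residual z i := by
  have hρ := rho_pos hz.2
  have hp : 0 < ∏ i, residual z i := Finset.prod_pos fun i _ => hz.2 i
  rw [Psi, controlBarrier_eq hM hz, barrier_eq_neg_log_prod hz.2,
    ← Real.log_le_log_iff (by positivity) hp, Real.log_mul (Real.exp_ne_zero _) (by positivity),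
    Real.log_exp, Real.log_pow]
  push_cast
  constructor <;> intro h <;> linarith

theorem exists_correctorStep (hM : IsMonotoneMatrix M) (hz : z ∈ strictSet M q) :
    ∃ z', CorrectorStep M q z z' := by
  obtain ⟨dx, ds, hd⟩ := exists_isDirection hM hz.1.2.1 hz.1.2.2 (rhsCorrector z)
  have hx : Continuous fun t : ℝ => z.x + t • dx := by fun_prop
  have hs : Continuous fun t : ℝ => z.s + t • ds := by fun_prop
  have hr : ∀ i, Continuous fun t : ℝ => residual (correctorPoint z dx ds t) i := fun i =>
    continuous_residual hx hs continuous_const continuous_const i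
  have hK : IsCompact (Set.Icc (0 : ℝ) 1 ∩ {t | (∀ i, 0 ≤ (z.x + t • dx) i) ∧
      (∀ i, 0 ≤ (z.s + t • ds) i) ∧ ∀ i, 0 ≤ residual (correctorPoint z dx ds t) i}) := by
    refine isCompact_Icc.inter_right ?_
    simp only [Set.ofPred_and, Set.ofPred_forall]
    refine (isClosed_iInter fun i => ?_).inter ((isClosed_iInter fun i => ?_).inter
      (isClosed_iInter fun i => isClosed_le continuous_const (hr i)))
    · exact isClosed_le continuous_const ((continuous_apply i).comp hx)
    · exact isClosed_le continuous_const ((continuous_apply i).comp hs)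
  have h0 : correctorPoint z dx ds 0 = z := by simp [correctorPoint]
  have hmem : ∀ t ∈ Set.Icc (0 : ℝ) 1, correctorPoint z dx ds t ∈ strictSet M q →
      t ∈ Set.Icc (0 : ℝ) 1 ∩ {t | (∀ i, 0 ≤ (z.x + t • dx) i) ∧
      (∀ i, 0 ≤ (z.s + t • ds) i) ∧ ∀ i, 0 ≤ residual (correctorPoint z dx ds t) i} :=
    fun t ht h => ⟨ht, fun i => (h.1.2.1 i).le, fun i => (h.1.2.2 i).le, fun i => (h.2 i).le⟩
  have h0mem := hmem 0 ⟨le_rfl, zero_le_one⟩ (by rwa [h0])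
  obtain ⟨t, ⟨ht, h1, h2, h3⟩, h4⟩ := hK.exists_isMaxOn ⟨0, h0mem⟩
    (continuous_finsetProd Finset.univ fun i _ => hr i).continuousOn
  have hp : 0 < ∏ i, residual (correctorPoint z dx ds t) i := by
    have h5 : ∏ i, residual (correctorPoint z dx ds 0) i
      ≤ ∏ i, residual (correctorPoint z dx ds t) i := h4 h0mem
    rw [h0] at h5
    exact (Finset.prod_pos fun i _ => hz.2 i).trans_le h5
  have hst : correctorPoint z dx ds t ∈ strictSet M q :=
    mem_strictSet_of_prod_pos ⟨hd.mem_affine hz.1.1 t, h1, h2⟩ h3 hp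
  refine ⟨_, dx, ds, t, hd, ⟨ht, hst⟩, fun t' ht' hst' => ?_, rfl⟩
  rw [barrier_eq_neg_log_prod hst.2, barrier_eq_neg_log_prod hst'.2, neg_le_neg_iff]
  exact Real.log_le_log (Finset.prod_pos fun i _ => hst'.2 i) (h4 (hmem t' ht' hst'))

theorem CorrectorStep.w_eq {z' : Point n} (h : CorrectorStep M q z z') : z'.w = z.w := by
  obtain ⟨dx, ds, α, -, -, -, rfl⟩ := h
  rfl

theorem CorrectorStep.mem_strictSet {z' : Point n} (h : CorrectorStep M q z z') :
    z' ∈ strictSet M q := by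
  obtain ⟨dx, ds, α, -, h1, -, rfl⟩ := h
  exact h1.2

theorem CorrectorStep.Psi_le {z' : Point n} {β : ℝ} (hβ : 0 < β) (hM : IsMonotoneMatrix M)
    (h : CorrectorStep M q z z') (hz : z ∈ strictSet M q) (hδ : z ∉ nbhdDelta M q β) :
    Psi M q z' ≤ Psi M q z - omega (β / Real.sqrt (1 + 2 * β)) := by
  have hδ' : β < delta z := by
    by_contra hle
    exact hδ ⟨hz, not_lt.mp hle⟩
  rw [Psi, Psi, h.w_eq]
  obtain ⟨dx, ds, α, hd, -, hmin, rfl⟩ := h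
  obtain ⟨t, ht, ht1, ht2⟩ := exists_corrector_decrease hM hd hz (hβ.trans hδ')
  have h1 := hmin t ht ht1
  have h2 := omega_le_omega (div_nonneg hβ.le (Real.sqrt_nonneg _)) (div_sqrt_le hβ.le hδ'.le)
  linarith

end

section

variable {n : ℕ} {M : Matrix (Fin n) (Fin n) ℝ} {q : Fin n → ℝ} {z : Point n}
  {dx ds : Fin n → ℝ} {p : Predictor}

/-- The weight of the corrector part in a predictor direction. -/
def Predictor.weight : Predictor → ℝ
  | .universalTangent => 0
  | .autoCorrector => 1

/-- The vector `(0, v²)`. -/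
def squares (v : Fin n → ℝ) : Fin (n + 1) → ℝ := Fin.cons 0 fun i => v i ^ 2

theorem rhsPredictor_eq (p : Predictor) (z : Point n) (i : Fin n) :
    rhsPredictor p z i = (z.w.v ⬝ᵥ z.w.v) / ((n : ℝ) + 1) - rho z.w - 2 * z.w.v i ^ 2
      + p.weight * (rho z.w - residual z i.succ) := by
  cases p
  · simp [rhsPredictor, rhsUniversalTangent, Predictor.weight]
  · simp only [rhsPredictor, rhsAutoCorrector, rhsUniversalTangent, rhsCorrector,
      Predictor.weight, residual_succ]
    ring

theorem residual_predictorPoint (h : IsDirection M z (rhsPredictor p z) dx ds) (t : ℝ)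
    (i : Fin (n + 1)) :
    residual (predictorPoint z dx ds t) i
      = residual z i + t * ((z.w.v ⬝ᵥ z.w.v) / ((n : ℝ) + 1) - rho z.w
          + p.weight * (rho z.w - residual z i))
        + t ^ 2 * (curvature dx ds i - squares z.w.v i) := by
  have hn : (n : ℝ) + 1 ≠ 0 := by positivity
  refine Fin.cases ?_ (fun i => ?_) i
  · have h1 := h.dotProduct_eq t
    have h3 := sum_residual z
    rw [Fin.sum_univ_succ] at h3
    have h2 : ∑ i, rhsPredictor p z i = n * ((z.w.v ⬝ᵥ z.w.v) / ((n : ℝ) + 1) - rho z.w)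
        - 2 * (z.w.v ⬝ᵥ z.w.v) - p.weight * (rho z.w - residual z 0) := by
      simp only [rhsPredictor_eq, Finset.sum_add_distrib, Finset.sum_sub_distrib,
        ← Finset.mul_sum, Finset.sum_const, Finset.card_univ, Fintype.card_fin, nsmul_eq_mul]
      have h4 : ∑ i, z.w.v i ^ 2 = z.w.v ⬝ᵥ z.w.v :=
        Finset.sum_congr rfl fun i _ => pow_two _
      rw [h4]
      have h5 : ∑ i : Fin n, residual z i.succ = ((n : ℝ) + 1) * rho z.w - residual z 0 := by
        linarith
      rw [h5]
      ring
    rw [h2] at h1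
    have h5 : residual (predictorPoint z dx ds t) 0
      = (1 - t) * z.w.v0 - (z.x + t • dx) ⬝ᵥ (z.s + t • ds) := rfl
    have h6 : curvature dx ds 0 = -(dx ⬝ᵥ ds) := rfl
    have h7 : squares z.w.v 0 = 0 := rfl
    rw [h5, h1, residual_zero, h6, h7, rho]
    field_simp
    ring
  · have h1 := h.mul_eq t i
    have h5 : residual (predictorPoint z dx ds t) i.succ
      = (z.x + t • dx) i * (z.s + t • ds) i - ((1 - t) * z.w.v i) ^ 2 := rfl
    have h6 : curvature dx ds i.succ = dx i * ds i := rfl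
    have h7 : squares z.w.v i.succ = z.w.v i ^ 2 := rfl
    rw [h5, h1, rhsPredictor_eq, h6, h7]
    have h8 := residual_succ z i
    generalize residual z i.succ = r at *
    rw [h8]
    ring

theorem rho_predictorPoint (z : Point n) (dx ds : Fin n → ℝ) (t : ℝ) :
    rho (predictorPoint z dx ds t).w
      = (1 - t) * (rho z.w + t * ((z.w.v ⬝ᵥ z.w.v) / ((n : ℝ) + 1))) := by
  have hn : (n : ℝ) + 1 ≠ 0 := by positivity
  simp only [predictorPoint, rho, smul_dotProduct, dotProduct_smul, smul_eq_mul]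
  field_simp
  ring

theorem scaled_bounds (hr : ∀ i, 0 < residual z i) (hδ : delta z ≤ 1 / 4) :
    (∀ i, 3 / 4 ≤ residual z i / rho z.w ∧ residual z i / rho z.w ≤ 3 / 2) ∧
      ∑ i, (residual z i / rho z.w - 1) ^ 2 ≤ 1 / 8 ∧ zeta0 z ^ 2 ≤ 1 / 12 := by
  have hd0 := delta_nonneg z
  have hζ0 := zeta1_nonneg z
  have hζ : zeta1 z ≤ 1 / 3 := by
    have := zeta1_le hr
    nlinarith
  have h0 : zeta0 z ^ 2 ≤ 1 / 12 := by
    rw [← delta_mul_zeta1 hr]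
    nlinarith
  have hb : ∀ i, 3 / 4 ≤ residual z i / rho z.w ∧ residual z i / rho z.w ≤ 3 / 2 := by
    intro i
    have h1 := abs_le.mp ((abs_le_zeta1 hr i).trans hζ)
    have hy := div_pos (hr i) (rho_pos hr)
    generalize residual z i / rho z.w = y at *
    have h2 : 1 / y * y = 1 := by field_simp
    constructor <;> nlinarith
  refine ⟨hb, ?_, h0⟩
  have h1 : ∑ i, (residual z i / rho z.w - 1) ^ 2 ≤ 3 / 2 * zeta0 z ^ 2 := by
    rw [zeta0_sq hr, Finset.mul_sum]
    refine Finset.sum_le_sum fun i _ => ?_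
    have hy := div_pos (hr i) (rho_pos hr)
    have h2 := (hb i).2
    generalize residual z i / rho z.w = y at *
    have h3 : (y - 1) ^ 2 = y * ((y - 1) ^ 2 / y) := by field_simp
    calc (y - 1) ^ 2 = y * ((y - 1) ^ 2 / y) := h3
      _ ≤ _ := mul_le_mul_of_nonneg_right h2 (by positivity)
  linarith

theorem nbhdDelta_subset_nbhdPsi (hM : IsMonotoneMatrix M) {τ : ℝ} (hτ : 1 / 12 ≤ τ)
    (hz : z ∈ nbhdDelta M q (1 / 4)) : z ∈ nbhdPsi M q τ := by
  refine ⟨hz.1, ?_⟩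
  have hr := hz.1.2
  rw [Psi_eq hM hz.1, ← Finset.sum_neg_distrib]
  refine le_trans ?_ hτ
  refine le_trans ?_ (scaled_bounds hr hz.2).2.2
  rw [zeta0_sq_eq_sum hr]
  refine Finset.sum_le_sum fun i _ => ?_
  have hy := div_pos (hr i) (rho_pos hr)
  rw [← Real.log_inv, ← one_div]
  exact Real.log_le_sub_one_of_pos (by positivity)

theorem universalTangent_sq_div_le {κ b y : ℝ} (hb : 0 ≤ b) (hy : 3 / 4 ≤ y) :
    (κ - 1 - 2 * b) ^ 2 / (2 * (y + b)) ≤ 2 / 3 * (κ + 1) ^ 2 + 8 / 3 * (b - κ) := by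
  have h1 : (κ - 1 - 2 * b) ^ 2 / (2 * (y + b)) ≤ (κ - 1 - 2 * b) ^ 2 / (3 / 2 * (1 + b)) :=
    div_le_div_of_nonneg_left (sq_nonneg _) (by positivity) (by linarith)
  refine h1.trans ?_
  rw [div_le_iff₀ (by positivity)]
  nlinarith [mul_nonneg hb (sq_nonneg (κ + 1))]

theorem autoCorrector_sq_div_le {κ b y : ℝ} (hκ : 0 ≤ κ) (hb : 0 ≤ b) (hy : 3 / 4 ≤ y)
    (hy' : y ≤ 3 / 2) :
    (κ - 1 - 2 * b + (1 - y)) ^ 2 / (2 * (y + b)) ≤ 3 / 4 * (κ + 1) ^ 2 + 2 * (b - κ) := by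
  have h1 : (κ + y) ^ 2 ≤ 3 / 2 * y * (κ + 1) ^ 2 := by
    nlinarith [mul_nonneg hκ hκ, mul_nonneg hκ (sub_nonneg.mpr hy),
      mul_nonneg (mul_nonneg hκ hκ) (sub_nonneg.mpr hy)]
  have h2 : (κ + y) ^ 2 ≤ 3 / 2 * (y + b) * (κ + 1) ^ 2 := by
    nlinarith [mul_nonneg hb (sq_nonneg (κ + 1))]
  rw [div_le_iff₀ (by positivity)]
  nlinarith

theorem sum_sq_add_le {ι : Type*} [Fintype ι] {f g : ι → ℝ} {F G : ℝ}
    (hf : ∑ i, f i ^ 2 ≤ F) (hg : ∑ i, |g i| ≤ G) :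
    ∑ i, (f i + g i) ^ 2 ≤ 7 / 5 * F + 7 / 2 * G ^ 2 := by
  have hg0 : 0 ≤ ∑ i, |g i| := Finset.sum_nonneg fun i _ => abs_nonneg _
  have hg2 : ∑ i, g i ^ 2 ≤ G ^ 2 := by
    calc ∑ i, g i ^ 2 = ∑ i, |g i| * |g i| := Finset.sum_congr rfl fun i _ => by
          rw [← sq_abs, pow_two]
      _ ≤ ∑ i, |g i| * ∑ j, |g j| := Finset.sum_le_sum fun i _ =>
          mul_le_mul_of_nonneg_left (Finset.single_le_sum (f := fun i => |g i|)
            (fun j _ => abs_nonneg _) (Finset.mem_univ i)) (abs_nonneg _)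
      _ = (∑ i, |g i|) ^ 2 := by rw [← Finset.sum_mul, pow_two]
      _ ≤ G ^ 2 := pow_le_pow_left₀ hg0 hg 2
  calc ∑ i, (f i + g i) ^ 2 ≤ ∑ i, (7 / 5 * f i ^ 2 + 7 / 2 * g i ^ 2) :=
        Finset.sum_le_sum fun i _ => by nlinarith [sq_nonneg (2 * f i - 5 * g i)]
    _ = 7 / 5 * ∑ i, f i ^ 2 + 7 / 2 * ∑ i, g i ^ 2 := by
        rw [Finset.sum_add_distrib, Finset.mul_sum, Finset.mul_sum]
    _ ≤ _ := by linarith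

/-- The ratio `(‖v‖² / (n + 1)) / ρ(w)`. -/
def weightRatio (w : Target n) : ℝ := (w.v ⬝ᵥ w.v) / ((n : ℝ) + 1) / rho w

theorem weightRatio_nonneg (hr : ∀ i, 0 < residual z i) : 0 ≤ weightRatio z.w := by
  have : 0 ≤ z.w.v ⬝ᵥ z.w.v := Finset.sum_nonneg fun i _ => mul_self_nonneg _
  exact div_nonneg (div_nonneg this (by positivity)) (rho_pos hr).le

theorem rho_predictorPoint' (hr : ∀ i, 0 < residual z i) (dx ds : Fin n → ℝ) (t : ℝ) :
    rho (predictorPoint z dx ds t).w = rho z.w * ((1 - t) * (1 + t * weightRatio z.w)) := by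
  have := (rho_pos hr).ne'
  rw [rho_predictorPoint, weightRatio]
  generalize (z.w.v ⬝ᵥ z.w.v) / ((n : ℝ) + 1) = c at *
  field_simp

theorem sum_squares_div (hr : ∀ i, 0 < residual z i) :
    ∑ i, z.w.v i ^ 2 / rho z.w = ((n : ℝ) + 1) * weightRatio z.w := by
  have hn : (n : ℝ) + 1 ≠ 0 := by positivity
  have := (rho_pos hr).ne'
  have h4 : ∑ i, z.w.v i ^ 2 = z.w.v ⬝ᵥ z.w.v :=
    Finset.sum_congr rfl fun i _ => pow_two _
  rw [← Finset.sum_div, h4, weightRatio]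
  field_simp

theorem sum_abs_curvature_predictor_le (hn : 1 ≤ n) (hM : IsMonotoneMatrix M)
    (hz : z ∈ nbhdDelta M q (1 / 4)) (h : IsDirection M z (rhsPredictor p z) dx ds) :
    ∑ i, |curvature dx ds i| ≤ rho z.w * (4 / 3 * n * (weightRatio z.w + 1) ^ 2) := by
  obtain ⟨⟨⟨-, hx, hs⟩, hr⟩, hδ⟩ := hz
  have hρ := rho_pos hr
  have hκ := weightRatio_nonneg hr
  have hn' : (1 : ℝ) ≤ n := by exact_mod_cast hn
  have hsq := sum_squares_div hr
  refine (h.sum_abs_curvature_le hM hx hs).trans ?_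
  have hterm : ∀ i, rhsPredictor p z i ^ 2 / (2 * (z.x i * z.s i)) = rho z.w *
      ((weightRatio z.w - 1 - 2 * (z.w.v i ^ 2 / rho z.w)
        + p.weight * (1 - residual z i.succ / rho z.w)) ^ 2
      / (2 * (residual z i.succ / rho z.w + z.w.v i ^ 2 / rho z.w))) := by
    intro i
    have h1 : rhsPredictor p z i = rho z.w * (weightRatio z.w - 1
        - 2 * (z.w.v i ^ 2 / rho z.w) + p.weight * (1 - residual z i.succ / rho z.w)) := by
      rw [rhsPredictor_eq, weightRatio]
      generalize (z.w.v ⬝ᵥ z.w.v) / ((n : ℝ) + 1) = c at *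
      field_simp
    have h2 : z.x i * z.s i
        = rho z.w * (residual z i.succ / rho z.w + z.w.v i ^ 2 / rho z.w) := by
      field_simp
      rw [residual_succ]
      ring
    rw [h1, h2]
    have hb : 0 ≤ z.w.v i ^ 2 / rho z.w := by positivity
    have hy := div_pos (hr i.succ) hρ
    generalize residual z i.succ / rho z.w = y at *
    generalize z.w.v i ^ 2 / rho z.w = b at *
    have : y + b ≠ 0 := by positivity
    field_simp
  simp only [hterm, ← Finset.mul_sum]
  refine mul_le_mul_of_nonneg_left ?_ hρ.le
  have hb := (scaled_bounds hr hδ).1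
  have hv : ∀ i, 0 ≤ z.w.v i ^ 2 / rho z.w := fun i => by positivity
  have hsum : ∀ A B : ℝ, ∑ i, (A * (weightRatio z.w + 1) ^ 2
      + B * (z.w.v i ^ 2 / rho z.w - weightRatio z.w))
      = n * A * (weightRatio z.w + 1) ^ 2 + B * weightRatio z.w := fun A B => by
    rw [Finset.sum_add_distrib, ← Finset.mul_sum, ← Finset.mul_sum, Finset.sum_sub_distrib, hsq]
    simp
    ring
  have hk : 4 * weightRatio z.w ≤ n * (weightRatio z.w + 1) ^ 2 := by
    nlinarith [sq_nonneg (weightRatio z.w - 1), sq_nonneg (weightRatio z.w + 1)]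
  have hk0 : 0 ≤ n * (weightRatio z.w + 1) ^ 2 := by positivity
  cases p
  · calc _ ≤ ∑ i, (2 / 3 * (weightRatio z.w + 1) ^ 2
        + 8 / 3 * (z.w.v i ^ 2 / rho z.w - weightRatio z.w)) :=
          Finset.sum_le_sum fun i _ => by
            simp only [Predictor.weight, zero_mul, add_zero]
            exact universalTangent_sq_div_le (hv i) (hb i.succ).1
      _ ≤ _ := by rw [hsum]; linarith
  · calc _ ≤ ∑ i, (3 / 4 * (weightRatio z.w + 1) ^ 2
        + 2 * (z.w.v i ^ 2 / rho z.w - weightRatio z.w)) :=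
          Finset.sum_le_sum fun i _ => by
            simp only [Predictor.weight, one_mul]
            exact autoCorrector_sq_div_le hκ (hv i) (hb i.succ).1 (hb i.succ).2
      _ ≤ _ := by rw [hsum]; linarith

/-- A guaranteed predictor step length. -/
def predictorLength (w : Target n) : ℝ :=
  1 / (4 * Real.sqrt n) / (1 + weightRatio w * (1 - 1 / (4 * Real.sqrt n)))

theorem inv_four_sqrt_bounds (hn : 1 ≤ n) :
    0 < 1 / (4 * Real.sqrt n) ∧ 1 / (4 * Real.sqrt n) ≤ 1 / 4 ∧
      (1 / (4 * Real.sqrt n)) ^ 2 * n = 1 / 16 := by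
  have hn' : (1 : ℝ) ≤ n := by exact_mod_cast hn
  have h1 : 1 ≤ Real.sqrt n := Real.one_le_sqrt.mpr hn'
  refine ⟨by positivity, ?_, ?_⟩
  · exact one_div_le_one_div_of_le (by norm_num) (by linarith)
  · rw [div_pow, mul_pow, Real.sq_sqrt (by positivity)]
    field_simp
    norm_num

theorem predictorLength_bounds (hn : 1 ≤ n) (hr : ∀ i, 0 < residual z i) :
    0 < predictorLength z.w ∧ predictorLength z.w ≤ 1 / 4 := by
  obtain ⟨h1, h2, -⟩ := inv_four_sqrt_bounds hn
  have hκ := weightRatio_nonneg hr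
  have h3 : 0 ≤ weightRatio z.w * (1 - 1 / (4 * Real.sqrt n)) := mul_nonneg hκ (by linarith)
  refine ⟨div_pos h1 (by linarith), (div_le_self h1.le (by linarith)).trans h2⟩

theorem sum_sq_scaled_predictorPoint_le (hn : 1 ≤ n) (hM : IsMonotoneMatrix M)
    (hz : z ∈ nbhdDelta M q (1 / 4)) (h : IsDirection M z (rhsPredictor p z) dx ds) :
    ∑ i, (residual (predictorPoint z dx ds (predictorLength z.w)) i
      / rho (predictorPoint z dx ds (predictorLength z.w)).w - 1) ^ 2 ≤ (2 / 3) ^ 2 := by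
  have hcurv := sum_abs_curvature_predictor_le hn hM hz h
  obtain ⟨⟨-, hr⟩, hδ⟩ := hz
  obtain ⟨-, hy, -⟩ := scaled_bounds hr hδ
  have hρ := rho_pos hr
  have hκ := weightRatio_nonneg hr
  have hn' : (1 : ℝ) ≤ n := by exact_mod_cast hn
  obtain ⟨ht0, ht1⟩ := predictorLength_bounds hn hr
  obtain ⟨hθ0, hθ1, hθn⟩ := inv_four_sqrt_bounds hn
  have hsq := sum_squares_div hr
  have htdef : predictorLength z.w
    = 1 / (4 * Real.sqrt n) / (1 + weightRatio z.w * (1 - 1 / (4 * Real.sqrt n))) := rfl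
  have hw : 0 ≤ p.weight ∧ p.weight ≤ 1 := by cases p <;> norm_num [Predictor.weight]
  have hres : ∀ i, residual (predictorPoint z dx ds (predictorLength z.w)) i
      = rho z.w * ((1 - predictorLength z.w) * (1 + predictorLength z.w * weightRatio z.w)
        + (1 - p.weight * predictorLength z.w) * (residual z i / rho z.w - 1)
        + predictorLength z.w ^ 2 * ((curvature dx ds i - squares z.w.v i) / rho z.w
          + weightRatio z.w)) := by
    intro i
    rw [residual_predictorPoint h, weightRatio]
    generalize (z.w.v ⬝ᵥ z.w.v) / ((n : ℝ) + 1) = c at *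
    field_simp
    ring
  simp only [hres, rho_predictorPoint' hr]
  generalize predictorLength z.w = t at *
  generalize weightRatio z.w = κ at *
  generalize 1 / (4 * Real.sqrt n) = θ at *
  have hD : 0 < 1 + κ * (1 - θ) := by nlinarith
  have h1 : 1 - t = (1 + κ) * (1 - θ) / (1 + κ * (1 - θ)) := by
    rw [htdef]; field_simp; ring
  have h2 : 1 + t * κ = (1 + κ) / (1 + κ * (1 - θ)) := by
    rw [htdef]; field_simp; ring
  have hQ : (1 - t) * (1 + t * κ) = (1 - θ) * ((1 + κ) / (1 + κ * (1 - θ))) ^ 2 := by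
    rw [h1, h2]; ring
  have hQ34 : 3 / 4 ≤ (1 - t) * (1 + t * κ) := by
    have : 0 ≤ t * κ := by positivity
    nlinarith
  have htQ : t ^ 2 / ((1 - t) * (1 + t * κ)) = θ ^ 2 / ((1 - θ) * (κ + 1) ^ 2) := by
    have : 1 - θ ≠ 0 := by linarith
    have : 1 + κ ≠ 0 := by positivity
    have : κ + 1 ≠ 0 := by positivity
    rw [hQ, htdef]
    field_simp
    ring
  have htQ' : t ^ 2 / ((1 - t) * (1 + t * κ)) ≤ 4 / 3 * (θ ^ 2 / (κ + 1) ^ 2) := by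
    have h3 : 0 < 1 - θ := by linarith
    have h4 : θ ^ 2 / ((1 - θ) * (κ + 1) ^ 2) = 1 / (1 - θ) * (θ ^ 2 / (κ + 1) ^ 2) := by
      field_simp
    rw [htQ, h4]
    refine mul_le_mul_of_nonneg_right ?_ (by positivity)
    rw [div_le_iff₀ h3]
    linarith
  generalize (1 - t) * (1 + t * κ) = Q at *
  have hQ0 : 0 < Q := by linarith
  have hsplit : ∀ i, rho z.w * (Q + (1 - p.weight * t) * (residual z i / rho z.w - 1)
      + t ^ 2 * ((curvature dx ds i - squares z.w.v i) / rho z.w + κ)) / (rho z.w * Q) - 1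
      = (1 - p.weight * t) / Q * (residual z i / rho z.w - 1)
      + t ^ 2 / Q * ((curvature dx ds i - squares z.w.v i) / rho z.w + κ) := fun i => by
    field_simp
    ring
  simp only [hsplit]
  have hF : ∑ i, ((1 - p.weight * t) / Q * (residual z i / rho z.w - 1)) ^ 2 ≤ 2 / 9 := by
    simp only [mul_pow, ← Finset.mul_sum]
    have h3 : (1 - p.weight * t) / Q ≤ 4 / 3 := by
      rw [div_le_iff₀ hQ0]; nlinarith
    have h4 : 0 ≤ (1 - p.weight * t) / Q := div_nonneg (by nlinarith) hQ0.le
    have h5 : ((1 - p.weight * t) / Q) ^ 2 ≤ (4 / 3) ^ 2 := pow_le_pow_left₀ h4 h3 2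
    calc _ ≤ (4 / 3 : ℝ) ^ 2 * (1 / 8) := mul_le_mul h5 hy
          (Finset.sum_nonneg fun i _ => sq_nonneg _) (by norm_num)
      _ = 2 / 9 := by norm_num
  have hE : ∑ i, |(curvature dx ds i - squares z.w.v i) / rho z.w + κ|
      ≤ 7 / 3 * n * (κ + 1) ^ 2 := by
    have h3 : ∀ i, |(curvature dx ds i - squares z.w.v i) / rho z.w + κ|
        ≤ |curvature dx ds i| / rho z.w + squares z.w.v i / rho z.w + κ := fun i => by
      have hs0 : 0 ≤ squares z.w.v i := by
        refine Fin.cases ?_ (fun i => ?_) i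
        · exact le_rfl
        · exact sq_nonneg _
      have h4 : (0 : ℝ) ≤ squares z.w.v i / rho z.w := by positivity
      have h5 : |curvature dx ds i| / rho z.w = |curvature dx ds i / rho z.w| := by
        rw [abs_div, abs_of_pos hρ]
      rw [h5, sub_div, abs_le]
      constructor
      · linarith [neg_abs_le (curvature dx ds i / rho z.w)]
      · linarith [le_abs_self (curvature dx ds i / rho z.w)]
    refine (Finset.sum_le_sum fun i _ => h3 i).trans ?_
    rw [Finset.sum_add_distrib, Finset.sum_add_distrib, ← Finset.sum_div]
    have h4 : ∑ i, squares z.w.v i / rho z.w = ((n : ℝ) + 1) * κ := by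
      rw [Fin.sum_univ_succ, ← hsq]
      simp [squares]
    have h5 : (∑ i, |curvature dx ds i|) / rho z.w ≤ 4 / 3 * n * (κ + 1) ^ 2 := by
      rw [div_le_iff₀ hρ, mul_comm]
      exact hcurv
    rw [h4]
    simp
    have h6 : 0 ≤ (n : ℝ) * (κ - 1) ^ 2 := by positivity
    nlinarith [mul_nonneg (sub_nonneg.mpr hn') hκ]
  have hG : ∑ i, |t ^ 2 / Q * ((curvature dx ds i - squares z.w.v i) / rho z.w + κ)|
      ≤ 7 / 36 := by
    have h3 : 0 ≤ t ^ 2 / Q := by positivity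
    simp only [abs_mul, abs_of_nonneg h3, ← Finset.mul_sum]
    calc _ ≤ 4 / 3 * (θ ^ 2 / (κ + 1) ^ 2) * (7 / 3 * n * (κ + 1) ^ 2) :=
          mul_le_mul htQ' hE (Finset.sum_nonneg fun i _ => abs_nonneg _) (by positivity)
      _ = 28 / 9 * (θ ^ 2 * n) := by
          field_simp
          norm_num
      _ = 7 / 36 := by rw [hθn]; norm_num
  exact (sum_sq_add_le hF hG).trans (by norm_num)

theorem predictorPoint_mem_nbhdPsi (hn : 1 ≤ n) (hM : IsMonotoneMatrix M)
    (hz : z ∈ nbhdDelta M q (1 / 4)) (h : IsDirection M z (rhsPredictor p z) dx ds) :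
    predictorPoint z dx ds (predictorLength z.w) ∈ nbhdPsi M q (omegaStar (2 / 3)) := by
  have hsum := sum_sq_scaled_predictorPoint_le hn hM hz h
  obtain ⟨⟨hz1, hr⟩, hδ⟩ := hz
  have hb := (scaled_bounds hr hδ).1
  have hρ := rho_pos hr
  have hκ := weightRatio_nonneg hr
  obtain ⟨ht0, ht1⟩ := predictorLength_bounds hn hr
  have habs := abs_le_of_sum_sq_le (by norm_num) hsum
  have hlog := neg_sum_log_le (by norm_num) (by norm_num) hsum
  have hρ' : 0 < rho (predictorPoint z dx ds (predictorLength z.w)).w := by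
    rw [rho_predictorPoint' hr]
    have : 0 ≤ predictorLength z.w * weightRatio z.w := by positivity
    exact mul_pos hρ (mul_pos (by linarith) (by linarith))
  have hpos : ∀ i, 0 < residual (predictorPoint z dx ds (predictorLength z.w)) i := fun i => by
    have h1 := (abs_le.mp (habs i)).1
    have h2 : 0 < residual (predictorPoint z dx ds (predictorLength z.w)) i
      / rho (predictorPoint z dx ds (predictorLength z.w)).w := by linarith
    exact (div_pos_iff_of_pos_right hρ').mp h2
  have hmem : predictorPoint z dx ds (predictorLength z.w) ∈ strictSet M q := by
    refine ⟨h.strictlyFeasible hz1 (fun i => ?_) fun i => ?_, hpos⟩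
    · have h1 := hpos i.succ
      have h2 : residual (predictorPoint z dx ds (predictorLength z.w)) i.succ
        = (z.x + predictorLength z.w • dx) i * (z.s + predictorLength z.w • ds) i
          - ((1 - predictorLength z.w) * z.w.v i) ^ 2 := rfl
      rw [h2] at h1
      linarith [sq_nonneg ((1 - predictorLength z.w) * z.w.v i)]
    · have h1 := (hb i.succ).1
      rw [le_div_iff₀ hρ] at h1
      have h2 : z.x i * z.s i = residual z i.succ + z.w.v i ^ 2 := by
        rw [residual_succ]; ring
      have h3 : 0 ≤ (z.w.v ⬝ᵥ z.w.v) / ((n : ℝ) + 1) :=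
        div_nonneg (Finset.sum_nonneg fun i _ => mul_self_nonneg _) (by positivity)
      have h4 := sq_nonneg (z.w.v i)
      rw [rhsPredictor_eq, h2]
      have h5 := mul_nonneg ht0.le h3
      have h6 : predictorLength z.w * z.w.v i ^ 2 ≤ z.w.v i ^ 2 :=
        mul_le_of_le_one_left h4 (by linarith)
      have h7 : predictorLength z.w * rho z.w ≤ 1 / 4 * rho z.w :=
        mul_le_mul_of_nonneg_right ht1 hρ.le
      have h8 : predictorLength z.w * residual z i.succ ≤ 1 / 4 * residual z i.succ :=
        mul_le_mul_of_nonneg_right ht1 (hr _).le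
      have h9 := mul_pos ht0 hρ
      have h10 := hr i.succ
      cases p <;> simp only [Predictor.weight] <;> nlinarith
  refine ⟨hmem, ?_⟩
  rw [Psi_eq hM hmem]
  simp only [add_sub_cancel] at hlog
  rw [sum_scaled hpos] at hlog
  linarith

theorem meritStar_predictorPoint (hr : ∀ i, 0 < residual z i) (dx ds : Fin n → ℝ) {t : ℝ}
    (ht0 : 0 ≤ t) (ht : t < 1) :
    meritStar (predictorPoint z dx ds t).w
      = meritStar z.w * ((1 - t) / (1 + t * weightRatio z.w)) := by
  have hn : (0 : ℝ) < (n : ℝ) + 1 := by positivity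
  have h1 : ∀ w : Target n, meritStar w = w.v0 ^ 2 / (((n : ℝ) + 1) * rho w) := fun w => by
    rw [meritStar, rho, mul_div_cancel₀ _ hn.ne']
  have hρ := (rho_pos hr).ne'
  have hκ := weightRatio_nonneg hr
  have h2 : 1 - t ≠ 0 := by linarith
  have h3 : 1 + t * weightRatio z.w ≠ 0 := by positivity
  rw [h1, h1, rho_predictorPoint' hr]
  change ((1 - t) * z.w.v0) ^ 2 / _ = _
  field_simp

theorem meritStar_pos (hr : ∀ i, 0 < residual z i) (h0 : 0 < z.w.v0) : 0 < meritStar z.w := by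
  have hn : (0 : ℝ) < (n : ℝ) + 1 := by positivity
  have h := rho_pos hr
  rw [rho, div_pos_iff_of_pos_right hn] at h
  exact div_pos (by positivity) h

theorem v0_pos (hz : z ∈ strictSet M q) : 0 < z.w.v0 := by
  have h1 := hz.2 0
  rw [residual_zero] at h1
  have h2 : 0 ≤ z.x ⬝ᵥ z.s :=
    Finset.sum_nonneg fun i _ => (mul_pos (hz.1.2.1 i) (hz.1.2.2 i)).le
  linarith

theorem v0_le_meritStar (hr : ∀ i, 0 < residual z i) (h0 : 0 < z.w.v0) :
    z.w.v0 ≤ meritStar z.w := by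
  have hn : (0 : ℝ) < (n : ℝ) + 1 := by positivity
  have h := rho_pos hr
  rw [rho, div_pos_iff_of_pos_right hn] at h
  have h1 : 0 ≤ z.w.v ⬝ᵥ z.w.v := Finset.sum_nonneg fun i _ => mul_self_nonneg _
  rw [meritStar, le_div_iff₀ h]
  nlinarith

theorem meritStar_predictorPoint_le (hn : 1 ≤ n) (hr : ∀ i, 0 < residual z i)
    (h0 : 0 < z.w.v0) (dx ds : Fin n → ℝ) {t : ℝ} (ht0 : predictorLength z.w ≤ t) (ht : t < 1) :
    meritStar (predictorPoint z dx ds t).w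
      ≤ (1 - 1 / (4 * Real.sqrt n)) * meritStar z.w := by
  have hκ := weightRatio_nonneg hr
  obtain ⟨hl0, -⟩ := predictorLength_bounds hn hr
  obtain ⟨hθ0, hθ1, -⟩ := inv_four_sqrt_bounds hn
  have ht00 : 0 ≤ t := hl0.le.trans ht0
  rw [meritStar_predictorPoint hr dx ds ht00 ht, mul_comm]
  refine mul_le_mul_of_nonneg_right ?_ (meritStar_pos hr h0).le
  have h1 : 0 < 1 + t * weightRatio z.w := by positivity
  rw [div_le_iff₀ h1]
  rw [predictorLength] at ht0
  generalize weightRatio z.w = κ at *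
  generalize 1 / (4 * Real.sqrt n) = θ at *
  have hD : 0 < 1 + κ * (1 - θ) := by nlinarith
  rw [div_le_iff₀ hD] at ht0
  nlinarith

/-- A predictor step either stays in `𝓝_Ψ(τ)` or reaches the target `w = 0`. -/
theorem PredictorStep.cases (hn : 1 ≤ n) (hM : IsMonotoneMatrix M)
    (hz : z ∈ nbhdDelta M q (1 / 4)) {z' : Point n}
    (h : PredictorStep M q p (omegaStar (2 / 3)) z z') :
    (z' ∈ nbhdPsi M q (omegaStar (2 / 3)) ∧
      meritStar z'.w ≤ (1 - 1 / (4 * Real.sqrt n)) * meritStar z.w) ∨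
    (z'.w.v0 = 0 ∧ (z'.x, z'.s) ∈ feasible M q ∧ z'.x ⬝ᵥ z'.s ≤ 0) := by
  obtain ⟨dx, ds, α, hd, hα, rfl⟩ := h
  have h0 := v0_pos hz.1
  have hr := hz.1.2
  have hρ := rho_pos hr
  have hκ := weightRatio_nonneg hr
  obtain ⟨hl0, hl1⟩ := predictorLength_bounds hn hr
  have hlA := predictorPoint_mem_nbhdPsi hn hM hz hd
  have hlα : predictorLength z.w ≤ α := hα.1 ⟨⟨hl0.le, by linarith⟩, hlA⟩
  have hα1 : α ≤ 1 := hα.2 fun t ht => ht.1.2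
  set τ := omegaStar (2 / 3)
  have hx : Continuous fun t : ℝ => z.x + t • dx := by fun_prop
  have hs : Continuous fun t : ℝ => z.s + t • ds := by fun_prop
  have hrc : ∀ i, Continuous fun t : ℝ => residual (predictorPoint z dx ds t) i := fun i =>
    continuous_residual hx hs (v := fun t => (1 - t) • z.w.v) (by fun_prop)
      (v0 := fun t => (1 - t) * z.w.v0) (by fun_prop) i
  have hρc : Continuous fun t : ℝ => rho (predictorPoint z dx ds t).w := by
    simp only [rho_predictorPoint' hr]
    fun_prop
  have hC : IsClosed {t : ℝ | ((∀ i, 0 ≤ (z.x + t • dx) i) ∧ ∀ i, 0 ≤ (z.s + t • ds) i) ∧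
      (∀ i, 0 ≤ residual (predictorPoint z dx ds t) i) ∧
      Real.exp (-τ) * rho (predictorPoint z dx ds t).w ^ (n + 1)
        ≤ ∏ i, residual (predictorPoint z dx ds t) i} := by
    simp only [Set.ofPred_and, Set.ofPred_forall]
    refine ((isClosed_iInter fun i => ?_).inter (isClosed_iInter fun i => ?_)).inter
      ((isClosed_iInter fun i => isClosed_le continuous_const (hrc i)).inter ?_)
    · exact isClosed_le continuous_const ((continuous_apply i).comp hx)
    · exact isClosed_le continuous_const ((continuous_apply i).comp hs)
    · exact isClosed_le (continuous_const.mul (hρc.pow _))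
        (continuous_finsetProd _ fun i _ => hrc i)
  have hαC := hC.closure_subset_iff.mpr (fun t ht => ?_) (hα.mem_closure ⟨_, ⟨⟨hl0.le,
    by linarith⟩, hlA⟩⟩)
  swap
  · have h1 := ht.2.1
    exact ⟨⟨fun i => (h1.1.2.1 i).le, fun i => (h1.1.2.2 i).le⟩, fun i => (h1.2 i).le,
      (Psi_le_iff hM h1 τ).mp ht.2.2⟩
  obtain ⟨⟨hx0, hs0⟩, hr0, hprod⟩ := hαC
  have hfeas : ((predictorPoint z dx ds α).x, (predictorPoint z dx ds α).s) ∈ feasible M q :=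
    ⟨hd.mem_affine hz.1.1.1 α, hx0, hs0⟩
  rcases hα1.lt_or_eq with hlt | rfl
  · left
    have hρ' : 0 < rho (predictorPoint z dx ds α).w := by
      rw [rho_predictorPoint' hr]
      have : 0 ≤ α * weightRatio z.w := mul_nonneg (hl0.le.trans hlα) hκ
      exact mul_pos hρ (mul_pos (by linarith) (by linarith))
    have hst : predictorPoint z dx ds α ∈ strictSet M q :=
      mem_strictSet_of_prod_pos hfeas hr0 (lt_of_lt_of_le (by positivity) hprod)
    exact ⟨⟨hst, (Psi_le_iff hM hst τ).mpr hprod⟩,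
      meritStar_predictorPoint_le hn hr h0 dx ds hlα hlt⟩
  · right
    have h1 := hr0 0
    have h2 : (predictorPoint z dx ds 1).w.v0 = 0 := by simp [predictorPoint]
    rw [residual_zero, h2] at h1
    exact ⟨h2, hfeas, by linarith⟩

theorem exists_predictorStep (hM : IsMonotoneMatrix M) {τ : ℝ} (hz : z ∈ nbhdPsi M q τ) :
    ∃ z', PredictorStep M q p τ z z' := by
  obtain ⟨dx, ds, hd⟩ := exists_isDirection hM hz.1.1.2.1 hz.1.1.2.2 (rhsPredictor p z)
  have h0 : predictorPoint z dx ds 0 = z := by simp [predictorPoint]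
  have hne : {t : ℝ | t ∈ Set.Icc (0 : ℝ) 1 ∧ predictorPoint z dx ds t ∈ nbhdPsi M q τ}.Nonempty :=
    ⟨0, ⟨le_rfl, zero_le_one⟩, by rwa [h0]⟩
  exact ⟨_, dx, ds, _, hd, isLUB_csSup hne ⟨1, fun t ht => ht.1.2⟩, rfl⟩

end

section

variable {n : ℕ} {M : Matrix (Fin n) (Fin n) ℝ} {q : Fin n → ℝ}

/-- The merit function after `k` outer iterations has decreased at the predicted rate. -/
def MeritDecrease (z₀ z : Point n) (k : ℕ) : Prop :=
  meritStar z.w ≤ (1 - 1 / (4 * Real.sqrt n)) ^ k * meritStar z₀.w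

/-- The pair `(x, s)` is an exact solution and the target is `w = 0`. -/
def Solved (M : Matrix (Fin n) (Fin n) ℝ) (q : Fin n → ℝ) (z : Point n) : Prop :=
  z.w.v0 = 0 ∧ (z.x, z.s) ∈ feasible M q ∧ z.x ⬝ᵥ z.s ≤ 0

/-- What holds at a configuration of the algorithm, depending on the phase; `d` is the decrease
of `Ψ` per corrector step. -/
def PhaseInvariant (M : Matrix (Fin n) (Fin n) ℝ) (q : Fin n → ℝ) (z₀ : Point n) (τ ε d : ℝ) :
    Config n → Prop
  | ⟨.outer, z, k, _⟩ => (z ∈ nbhdDelta M q (1 / 4) ∧ MeritDecrease z₀ z k) ∨ Solved M q z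
  | ⟨.inner, z, k, c⟩ =>
      (z ∈ strictSet M q ∧ Psi M q z + c * d ≤ τ ∧ MeritDecrease z₀ z k) ∨ Solved M q z
  | ⟨.halted, z, _, _⟩ => (z.x, z.s) ∈ feasible M q ∧ z.x ⬝ᵥ z.s ≤ ε

/-- The number of outer iterations in the complexity bound. -/
def maxIterations (z₀ : Point n) (ε : ℝ) : ℕ :=
  ⌈4 * Real.sqrt n * Real.log (meritStar z₀.w / ε)⌉₊

/-- The invariant of the algorithm. -/
def Invariant (M : Matrix (Fin n) (Fin n) ℝ) (q : Fin n → ℝ) (z₀ : Point n) (τ ε d : ℝ)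
    (c : Config n) : Prop :=
  c.iters ≤ maxIterations z₀ ε ∧ c.correctors ≤ ⌊τ / d⌋₊ ∧ PhaseInvariant M q z₀ τ ε d c

theorem lt_maxIterations (hn : 1 ≤ n) {ε : ℝ} (hε : 0 < ε) {z₀ z : Point n} {k : ℕ}
    (hz₀ : z₀ ∈ strictSet M q) (hz : z ∈ strictSet M q) (hv : ε < z.w.v0)
    (h : MeritDecrease z₀ z k) : k < maxIterations z₀ ε := by
  obtain ⟨hθ0, hθ1, -⟩ := inv_four_sqrt_bounds hn
  have hs : 0 < 4 * Real.sqrt n := one_div_pos.mp hθ0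
  have h1 : ε < (1 - 1 / (4 * Real.sqrt n)) ^ k * meritStar z₀.w :=
    hv.trans_le ((v0_le_meritStar hz.2 (v0_pos hz)).trans h)
  have hμ := meritStar_pos hz₀.2 (v0_pos hz₀)
  have hθ : 0 < 1 - 1 / (4 * Real.sqrt n) := by linarith
  have h2 := Real.log_lt_log hε h1
  rw [Real.log_mul (by positivity) hμ.ne', Real.log_pow] at h2
  have h3 := Real.log_le_sub_one_of_pos hθ
  have h4 : (k : ℝ) * Real.log (1 - 1 / (4 * Real.sqrt n)) ≤ -((k : ℝ) / (4 * Real.sqrt n)) := by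
    have := mul_le_mul_of_nonneg_left h3 (Nat.cast_nonneg k)
    refine this.trans (le_of_eq ?_)
    ring
  rw [maxIterations, Nat.lt_ceil, Real.log_div hμ.ne' hε.ne', mul_comm, ← div_lt_iff₀ hs]
  linarith

theorem solved_halts {z : Point n} {ε : ℝ} (hε : 0 < ε) (h : Solved M q z) :
    (z.x, z.s) ∈ feasible M q ∧ z.x ⬝ᵥ z.s ≤ ε :=
  ⟨h.2.1, h.2.2.trans hε.le⟩

theorem Invariant.step (hn : 1 ≤ n) (hM : IsMonotoneMatrix M) {p : Predictor} {ε d : ℝ}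
    {z₀ : Point n} (hε : 0 < ε) (hz₀ : z₀ ∈ strictSet M q)
    (hd : d = omega (1 / 4 / Real.sqrt (1 + 2 * (1 / 4)))) {c c' : Config n}
    (h : Invariant M q z₀ (omegaStar (2 / 3)) ε d c)
    (hs : Step M q p (1 / 4) (omegaStar (2 / 3)) ε c c') :
    Invariant M q z₀ (omegaStar (2 / 3)) ε d c' := by
  obtain ⟨h1, h2, h3⟩ := h
  have hd0 : 0 < d := hd ▸ omega_pos (div_pos (by norm_num) (Real.sqrt_pos.mpr (by norm_num)))
  cases hs with
  | finish hv =>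
    refine ⟨h1, h2, ?_⟩
    rcases h3 with h3 | h3
    · refine ⟨strictSet_feasible h3.1.1, ?_⟩
      have := h3.1.1.2 0
      rw [residual_zero] at this
      linarith
    · exact solved_halts hε h3
  | @predictor z z' k i hv hstep =>
    rcases h3 with h3 | h3
    · refine ⟨lt_maxIterations hn hε hz₀ h3.1.1 hv h3.2, Nat.zero_le _, ?_⟩
      rcases hstep.cases hn hM h3.1 with h4 | h4
      · refine Or.inl ⟨h4.1.1, by simpa using h4.1.2, ?_⟩
        obtain ⟨-, hθ1, -⟩ := inv_four_sqrt_bounds hn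
        refine h4.2.trans ?_
        rw [pow_succ', mul_assoc]
        exact mul_le_mul_of_nonneg_left h3.2 (by linarith)
      · exact Or.inr h4
    · linarith [h3.1]
  | leave hl =>
    refine ⟨h1, h2, ?_⟩
    rcases h3 with h3 | h3
    · rcases hl with hl | hl
      · exact Or.inl ⟨hl, h3.2.2⟩
      · exact absurd hl (v0_pos h3.1).ne'
    · exact Or.inr h3
  | @corrector z z' k i hnot h0 hstep =>
    rcases h3 with h3 | h3
    · have h4 := hstep.Psi_le (by norm_num) hM h3.1 hnot
      rw [← hd] at h4
      have h5 : Psi M q z' + (i + 1 : ℕ) * d ≤ omegaStar (2 / 3) := by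
        push_cast
        linarith [h3.2.1]
      refine ⟨h1, ?_, Or.inl ⟨hstep.mem_strictSet, h5, ?_⟩⟩
      · refine Nat.le_floor ?_
        rw [le_div_iff₀ hd0]
        linarith [Psi_nonneg hM hstep.mem_strictSet]
      · have h6 := h3.2.2
        unfold MeritDecrease at h6 ⊢
        rwa [hstep.w_eq]
    · exact absurd h3.1 h0

/-- A quantity that increases in every step of the algorithm. -/
def progress (K : ℕ) : Config n → ℕ
  | ⟨.outer, _, k, _⟩ => k * (K + 3) + K + 1
  | ⟨.inner, _, k, c⟩ => k * (K + 3) + c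
  | ⟨.halted, _, k, _⟩ => k * (K + 3) + K + 2

theorem progress_lt {p : Predictor} {β τ ε : ℝ} {K : ℕ} {c c' : Config n}
    (hc : c.correctors ≤ K) (hs : Step M q p β τ ε c c') : progress K c < progress K c' := by
  cases hs <;> simp only [progress] at hc ⊢
  · omega
  · rw [add_one_mul]; omega
  · omega
  · omega

theorem progress_le {K B : ℕ} {c : Config n} (hc : c.correctors ≤ K) (hB : c.iters ≤ B) :
    progress K c ≤ B * (K + 3) + K + 2 := by
  obtain ⟨ph, z, k, i⟩ := c
  have := Nat.mul_le_mul_right (K + 3) hB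
  simp only at this hc
  cases ph <;> simp only [progress] <;> omega

theorem Invariant.exists_step (hM : IsMonotoneMatrix M) {p : Predictor} {ε d τ : ℝ}
    {z₀ : Point n} (hε : 0 < ε) (hτ : 1 / 12 ≤ τ) {c : Config n}
    (h : Invariant M q z₀ τ ε d c) (hc : c.phase ≠ Phase.halted) :
    ∃ c', Step M q p (1 / 4) τ ε c c' := by
  obtain ⟨-, -, h⟩ := h
  obtain ⟨ph, z, k, i⟩ := c
  cases ph with
  | outer =>
    rcases le_or_gt z.w.v0 ε with hv | hv
    · exact ⟨_, Step.finish hv⟩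
    · rcases h with h | h
      · obtain ⟨z', hz'⟩ := exists_predictorStep (p := p) hM (nbhdDelta_subset_nbhdPsi hM hτ h.1)
        exact ⟨_, Step.predictor hv hz'⟩
      · linarith [h.1]
  | inner =>
    by_cases h1 : z ∈ nbhdDelta M q (1 / 4) ∨ z.w.v0 = 0
    · exact ⟨_, Step.leave h1⟩
    · rw [not_or] at h1
      rcases h with h | h
      · obtain ⟨z', hz'⟩ := exists_correctorStep hM h.1
        exact ⟨_, Step.corrector h1.1 h1.2 hz'⟩
      · exact absurd h.1 h1.2
  | halted => exact absurd rfl hc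

theorem one_div_twelve_le_omegaStar : 1 / 12 ≤ omegaStar (2 / 3) := by
  have h := hasSum_omegaStar (x := 2 / 3) (by norm_num [abs_of_pos])
  refine le_trans ?_ (h.summable.le_tsum 0 fun k _ => by positivity) |>.trans_eq h.tsum_eq
  norm_num

end

end PTS

end

theorem theorem4p1 {n : ℕ} (hn : 1 ≤ n)
    (M : Matrix (Fin n) (Fin n) ℝ) (q : Fin n → ℝ)
    (hM : PTS.IsMonotoneMatrix M) (hF : (PTS.strictlyFeasible M q).Nonempty)
    (p : PTS.Predictor) (β τ ε : ℝ)
    (hβ : β = 1 / 4) (hτ : τ = PTS.omegaStar (2 * β / (1 - β))) (hε : 0 < ε)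
    (z₀ : PTS.Point n) (hz₀ : z₀ ∈ PTS.nbhdDelta M q β) :
    -- every run of the algorithm from `z₀` is finite
    (¬ ∃ c : ℕ → PTS.Config n, c 0 = PTS.initial z₀ ∧
      ∀ k, PTS.Step M q p β τ ε (c k) (c (k + 1))) ∧
    -- for every configuration `c` that the algorithm can reach from `z₀`
    ∀ c : PTS.Config n,
      Relation.ReflTransGen (PTS.Step M q p β τ ε) (PTS.initial z₀) c →
      -- at most `⌈4 √n ln (μ*(w⁽⁰⁾) / ε)⌉` outer iterations have been started
      c.iters ≤ ⌈4 * Real.sqrt n * Real.log (PTS.meritStar z₀.w / ε)⌉₊ ∧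
      -- the number of corrector steps in the current iteration is bounded by a constant
      c.correctors ≤ ⌊τ / PTS.omega (β / Real.sqrt (1 + 2 * β))⌋₊ + 1 ∧
      -- if the algorithm has halted, the output is feasible with `xᵀs ≤ ε`
      (c.phase = PTS.Phase.halted →
        (c.z.x, c.z.s) ∈ PTS.feasible M q ∧ c.z.x ⬝ᵥ c.z.s ≤ ε) ∧
      -- otherwise the next step of the algorithm is well defined
      (c.phase ≠ PTS.Phase.halted → ∃ c', PTS.Step M q p β τ ε c c') := by
  have hβτ : 2 * β / (1 - β) = 2 / 3 := by rw [hβ]; norm_num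
  rw [hβτ] at hτ
  subst hβ hτ
  set d := PTS.omega (1 / 4 / Real.sqrt (1 + 2 * (1 / 4))) with hd
  have hinit : PTS.Invariant M q z₀ (PTS.omegaStar (2 / 3)) ε d (PTS.initial z₀) :=
    ⟨Nat.zero_le _, Nat.zero_le _, Or.inl ⟨hz₀, by simp [PTS.MeritDecrease]⟩⟩
  refine ⟨?_, fun c hc => ?_⟩
  · rintro ⟨c, hc0, hc⟩
    have hinv : ∀ k, PTS.Invariant M q z₀ (PTS.omegaStar (2 / 3)) ε d (c k) := fun k => by
      induction k with
      | zero => rwa [hc0]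
      | succ k ih => exact ih.step hn hM hε hz₀.1 hd (hc k)
    have hmono : StrictMono fun k =>
        PTS.progress ⌊PTS.omegaStar (2 / 3) / d⌋₊ (c k) :=
      strictMono_nat_of_lt_succ fun k => PTS.progress_lt (hinv k).2.1 (hc k)
    have h1 := hmono.le_apply (x := PTS.maxIterations z₀ ε *
      (⌊PTS.omegaStar (2 / 3) / d⌋₊ + 3) + ⌊PTS.omegaStar (2 / 3) / d⌋₊ + 2 + 1)
    have h2 := PTS.progress_le (hinv (PTS.maxIterations z₀ ε *
      (⌊PTS.omegaStar (2 / 3) / d⌋₊ + 3) + ⌊PTS.omegaStar (2 / 3) / d⌋₊ + 2 + 1)).2.1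
      (hinv _).1
    omega
  · have hinv : PTS.Invariant M q z₀ (PTS.omegaStar (2 / 3)) ε d c := by
      induction hc with
      | refl => exact hinit
      | tail _ hs ih => exact ih.step hn hM hε hz₀.1 hd hs
    refine ⟨hinv.1, hinv.2.1.trans (Nat.le_succ _), fun hph => ?_, fun hph =>
      hinv.exists_step hM hε PTS.one_div_twelve_le_omegaStar hph⟩
    obtain ⟨ph, z, k, i⟩ := c
    subst hph
    exact hinv.2.2
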